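/- All Banach spaces are real. Let $X$ and $Y_k$, $k\in\mathbb N$, be Banach spaces. For every $k$ let $\|\cdot\|_{X\oplus Y_k}$ be a norm on $X\oplus Y_k$ which coincides with $\|\cdot\|_X$ on $X$ and with $\|\cdot\|_{Y_k}$ on $Y_k$, and which is monotone, i.e. $\|x+y_k\|_{X\oplus Y_k}\ge\|x\|_X$ for all $x\in X$, $y_k\in Y_k$. Write $\|x^*+y_k^*\|_{X\oplus Y_k}$ for the dual norm of the functional $x+y_k\mapsto x^*(x)+y_k^*(y_k)$, where $x^*\in X^*$, $y_k^*\in Y_k^*$. The generalized $\ell^2$-sum $\Sigma(X\oplus Y_k)$ is the space of all formal sums $z=x+y_1+y_2+\cdots$ with $x\in X$, $y_k\in Y_k$ and $\sum_{k}\|y_k\|_{Y_k}^2<\infty$, equipped with the norm $$\|z\|_\Sigma=\sup\{|z^*(z)| : z^*\in\Lambda\},$$ where $\Lambda$ is the set of all functionals $z^*=x^*+\sum_{k}\alpha_k y_k^*$, that is, $z^*(x+y_1+y_2+\cdots)=x^*(x)+\sum_k\alpha_k y_k^*(y_k)$, with $x^*\in X^*$, $y_k^*\in Y_k^*$, $\|x^*+y_k^*\|_{X\oplus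 Y_k}\le 1$ and $0\le\alpha_k\le 1$ for every $k$, and $\sum_{k}\alpha_k^2\le 1$. A Banach space is called Fréchet smooth if its norm is Fréchet differentiable at every nonzero point. Suppose that the dual of $(X\oplus Y_k,\|\cdot\|_{X\oplus Y_k})$ is Fréchet smooth for every $k\in\mathbb N$, and that there is a constant $c>0$ such that $$\|x+y_k\|_{X\oplus Y_k}\ \ge\ \|x\|_X+c\,\|y_k\|_{Y_k},\qquad k\in\mathbb N,\ x\in X,\ y_k\in Y_k.$$ Then the dual of $\Sigma(X\oplus Y_k)$ (with the dual norm of $\|\cdot\|_\Sigma$) is Fréchet smooth. -/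

import Mathlib

open scoped ENNReal

noncomputable section

/-- A normed space is Fréchet smooth if its norm is Fréchet differentiable at every nonzero point. -/
def FrechetSmooth (E : Type*) [NormedAddCommGroup E] [NormedSpace ℝ E] : Prop :=
  ∀ e : E, e ≠ 0 → DifferentiableAt ℝ (fun v : E => ‖v‖) e

/-- A family of norms on the direct sums `X ⊕ Y k` which coincide with the given norms on the
summands and are monotone. (Definiteness of `nrm k` follows from the three conditions.) -/
structure SumNorms (X : Type*) [NormedAddCommGroup X] [NormedSpace ℝ X]
    (Y : ℕ → Type*) [∀ k, NormedAddCommGroup (Y k)] [∀ k, NormedSpace ℝ (Y k)] where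
  nrm : ∀ k, Seminorm ℝ (X × Y k)
  nrm_left : ∀ k (x : X), nrm k (x, 0) = ‖x‖
  nrm_right : ∀ k (y : Y k), nrm k (0, y) = ‖y‖
  nrm_mono : ∀ k (x : X) (y : Y k), ‖x‖ ≤ nrm k (x, y)

namespace SumNorms

variable {X : Type*} [NormedAddCommGroup X] [NormedSpace ℝ X]
  {Y : ℕ → Type*} [∀ k, NormedAddCommGroup (Y k)] [∀ k, NormedSpace ℝ (Y k)]

/-- The direct sum `X ⊕ Y k`, to be normed by `S.nrm k`. -/
def Pair (_S : SumNorms X Y) (k : ℕ) : Type _ := X × Y k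

instance (S : SumNorms X Y) (k : ℕ) : AddCommGroup (S.Pair k) :=
  inferInstanceAs (AddCommGroup (X × Y k))

instance (S : SumNorms X Y) (k : ℕ) : Module ℝ (S.Pair k) :=
  inferInstanceAs (Module ℝ (X × Y k))

instance (S : SumNorms X Y) (k : ℕ) : Norm (S.Pair k) := ⟨fun z => S.nrm k z⟩

theorem Pair.norm_def (S : SumNorms X Y) (k : ℕ) (z : S.Pair k) : ‖z‖ = S.nrm k z := rfl

theorem norm_snd_le (S : SumNorms X Y) (k : ℕ) (x : X) (y : Y k) :
    ‖y‖ ≤ 2 * S.nrm k (x, y) := by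
  have h : ((0 : X), y) = (x, y) + (-x, (0 : Y k)) := by simp
  have h1 := map_add_le_add (S.nrm k) (x, y) (-x, (0 : Y k))
  rw [← h, S.nrm_right, S.nrm_left, norm_neg] at h1
  linarith [S.nrm_mono k x y]

theorem Pair.core (S : SumNorms X Y) (k : ℕ) : NormedSpace.Core ℝ (S.Pair k) where
  norm_nonneg z := apply_nonneg (S.nrm k) z
  norm_smul c z := map_smul_eq_mul (S.nrm k) c z
  norm_triangle z w := map_add_le_add (S.nrm k) z w
  norm_eq_zero_iff z := by
    constructor
    · intro h
      obtain ⟨x, y⟩ := z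
      have h0 : S.nrm k (x, y) = 0 := h
      have h1 := S.nrm_mono k x y
      have h2 := S.norm_snd_le k x y
      rw [h0] at h1 h2
      have hx : x = 0 := norm_le_zero_iff.1 h1
      have hy : y = 0 := norm_le_zero_iff.1 (by simpa using h2)
      subst hx hy
      rfl
    · rintro rfl
      exact map_zero (S.nrm k)

instance (S : SumNorms X Y) (k : ℕ) : NormedAddCommGroup (S.Pair k) :=
  NormedAddCommGroup.ofCore (Pair.core S k)

instance (S : SumNorms X Y) (k : ℕ) : NormedSpace ℝ (S.Pair k) :=
  NormedSpace.ofCore (Pair.core S k)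

/-- The projection of `X ⊕ Y k` onto `X`. -/
def Pair.fst (S : SumNorms X Y) (k : ℕ) : S.Pair k →L[ℝ] X :=
  LinearMap.mkContinuous (LinearMap.fst ℝ X (Y k) : S.Pair k →ₗ[ℝ] X) 1
    (fun z => by rw [one_mul]; exact S.nrm_mono k z.1 z.2)

/-- The projection of `X ⊕ Y k` onto `Y k`. -/
def Pair.snd (S : SumNorms X Y) (k : ℕ) : S.Pair k →L[ℝ] Y k :=
  LinearMap.mkContinuous (LinearMap.snd ℝ X (Y k) : S.Pair k →ₗ[ℝ] Y k) 2
    (fun z => S.norm_snd_le k z.1 z.2)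

/-- The functional `x* + y*` on `X ⊕ Y k`, `(x* + y*) (x + y) = x* x + y* y`. -/
def Pair.functional (S : SumNorms X Y) (k : ℕ) (f : StrongDual ℝ X) (g : StrongDual ℝ (Y k)) :
    StrongDual ℝ (S.Pair k) :=
  f.comp (Pair.fst S k) + g.comp (Pair.snd S k)

theorem Pair.functional_apply (S : SumNorms X Y) (k : ℕ) (f : StrongDual ℝ X)
    (g : StrongDual ℝ (Y k)) (z : S.Pair k) : Pair.functional S k f g z = f z.1 + g z.2 := rfl

/-- The underlying vector space of the generalized `ℓ²`-sum: all `x + y₀ + y₁ + ⋯` with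
`∑ ‖y k‖ ^ 2 < ∞`. -/
def Sigma (_S : SumNorms X Y) : Type _ := X × lp Y 2

instance (S : SumNorms X Y) : AddCommGroup S.Sigma :=
  inferInstanceAs (AddCommGroup (X × lp Y 2))

instance (S : SumNorms X Y) : Module ℝ S.Sigma :=
  inferInstanceAs (Module ℝ (X × lp Y 2))

/-- The set of all functionals `x* + ∑ k, α k • y* k` where `‖x* + y* k‖ ≤ 1` on `X ⊕ Y k`,
`0 ≤ α k ≤ 1` and `∑ k, α k ^ 2 ≤ 1`. (The series `∑ k, α k * y* k (y k)` then always converges.) -/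
def Lam (S : SumNorms X Y) : Set (S.Sigma →ₗ[ℝ] ℝ) :=
  {φ | ∃ (f : StrongDual ℝ X) (g : ∀ k, StrongDual ℝ (Y k)) (α : ℕ → ℝ),
    (∀ k, ‖Pair.functional S k f (g k)‖ ≤ 1) ∧
    (∀ k, 0 ≤ α k ∧ α k ≤ 1) ∧
    (Summable (fun k => α k ^ 2) ∧ ∑' k, α k ^ 2 ≤ 1) ∧
    ∀ z : S.Sigma, HasSum (fun k => α k * g k (z.2 k)) (φ z - f z.1)}

/-- `‖z‖ = sup {|φ z| : φ ∈ Λ}`. -/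
instance (S : SumNorms X Y) : Norm S.Sigma := ⟨fun z => sSup {r : ℝ | ∃ φ ∈ S.Lam, r = |φ z|}⟩

theorem Sigma.norm_def (S : SumNorms X Y) (z : S.Sigma) :
    ‖z‖ = sSup {r : ℝ | ∃ φ ∈ S.Lam, r = |φ z|} := rfl

theorem abs_left_le (S : SumNorms X Y) (k : ℕ) {f : StrongDual ℝ X} {g : StrongDual ℝ (Y k)}
    (h : ‖Pair.functional S k f g‖ ≤ 1) (x : X) : |f x| ≤ ‖x‖ := by
  have h1 := (Pair.functional S k f g).le_of_opNorm_le h (show S.Pair k from (x, 0))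
  rw [Pair.functional_apply, Pair.norm_def] at h1
  change ‖f x + g 0‖ ≤ 1 * S.nrm k (x, 0) at h1
  rw [S.nrm_left, one_mul] at h1
  simpa using h1

theorem abs_right_le (S : SumNorms X Y) (k : ℕ) {f : StrongDual ℝ X} {g : StrongDual ℝ (Y k)}
    (h : ‖Pair.functional S k f g‖ ≤ 1) (y : Y k) : |g y| ≤ ‖y‖ := by
  have h1 := (Pair.functional S k f g).le_of_opNorm_le h (show S.Pair k from (0, y))
  rw [Pair.functional_apply, Pair.norm_def] at h1
  change ‖f 0 + g y‖ ≤ 1 * S.nrm k (0, y) at h1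
  rw [S.nrm_right, one_mul] at h1
  simpa using h1

theorem Sigma.summable_sq (S : SumNorms X Y) (z : S.Sigma) :
    Summable (fun k => ‖z.2 k‖ ^ 2) := by
  have h := (lp.memℓp z.2).summable (by norm_num)
  simpa using h

theorem Sigma.bddAbove (S : SumNorms X Y) (z : S.Sigma) :
    BddAbove {r : ℝ | ∃ φ ∈ S.Lam, r = |φ z|} := by
  refine ⟨‖z.1‖ + (1 + ∑' k, ‖z.2 k‖ ^ 2), ?_⟩
  rintro r ⟨φ, ⟨f, g, α, h1, h2, ⟨h3, h4⟩, h5⟩, rfl⟩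
  have hz := Sigma.summable_sq S z
  have hb : ∀ k, ‖α k * g k (z.2 k)‖ ≤ α k ^ 2 + ‖z.2 k‖ ^ 2 := by
    intro k
    rw [norm_mul, Real.norm_eq_abs, Real.norm_eq_abs, abs_of_nonneg (h2 k).1]
    have := mul_le_mul_of_nonneg_left (S.abs_right_le k (h1 k) (z.2 k)) (h2 k).1
    nlinarith [sq_nonneg (α k - ‖z.2 k‖), sq_nonneg (α k), sq_nonneg ‖z.2 k‖]
  have h6 := tsum_of_norm_bounded (h3.add hz).hasSum hb
  rw [(h5 z).tsum_eq, h3.tsum_add hz, Real.norm_eq_abs] at h6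
  have h7 := S.abs_left_le 0 (h1 0) z.1
  have h8 : |φ z| ≤ |φ z - f z.1| + |f z.1| := by
    simpa using abs_add_le (φ z - f z.1) (f z.1)
  linarith

theorem Sigma.le_norm (S : SumNorms X Y) (z : S.Sigma) {φ : S.Sigma →ₗ[ℝ] ℝ} (h : φ ∈ S.Lam) :
    |φ z| ≤ ‖z‖ :=
  le_csSup (Sigma.bddAbove S z) ⟨φ, h, rfl⟩

theorem zero_mem_Lam (S : SumNorms X Y) : (0 : S.Sigma →ₗ[ℝ] ℝ) ∈ S.Lam := by
  refine ⟨0, 0, 0, fun k => ?_, by simp, by simp, fun z => by simp [hasSum_zero]⟩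
  have : Pair.functional S k 0 ((0 : ∀ k, StrongDual ℝ (Y k)) k) = 0 := by
    ext z; simp [Pair.functional_apply]
  rw [this, norm_zero]
  exact zero_le_one

theorem Sigma.norm_le (S : SumNorms X Y) (z : S.Sigma) {a : ℝ}
    (h : ∀ φ ∈ S.Lam, |φ z| ≤ a) : ‖z‖ ≤ a := by
  refine csSup_le ⟨_, 0, S.zero_mem_Lam, rfl⟩ ?_
  rintro r ⟨φ, hφ, rfl⟩
  exact h φ hφ

theorem Sigma.norm_fst_le (S : SumNorms X Y) (z : S.Sigma) : ‖z.1‖ ≤ ‖z‖ := by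
  obtain ⟨f, hf, hfz⟩ := exists_dual_vector'' ℝ z.1
  let φ : S.Sigma →ₗ[ℝ] ℝ := f.toLinearMap.comp (LinearMap.fst ℝ X (lp Y 2))
  have hφ : φ ∈ S.Lam := by
    refine ⟨f, 0, 0, fun k => ?_, by simp, by simp, fun z => ?_⟩
    · refine ContinuousLinearMap.opNorm_le_bound _ zero_le_one fun w => ?_
      have h1 := f.le_of_opNorm_le hf w.1
      have h2 := S.nrm_mono k w.1 w.2
      rw [Pair.functional_apply, Pair.norm_def]
      simp only [Pi.zero_apply, zero_apply, add_zero]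
      exact h1.trans (mul_le_mul_of_nonneg_left h2 zero_le_one)
    · have : φ z - f z.1 = 0 := sub_self _
      rw [this]
      simp [hasSum_zero]
  have h := Sigma.le_norm S z hφ
  have h' : φ z = ‖z.1‖ := hfz
  rwa [h', abs_of_nonneg (norm_nonneg _)] at h

theorem Sigma.norm_snd_le (S : SumNorms X Y) (z : S.Sigma) (j : ℕ) : ‖z.2 j‖ ≤ 2 * ‖z‖ := by
  obtain ⟨f, hf, hfz⟩ := exists_dual_vector'' ℝ (z.2 j)
  let φ : S.Sigma →ₗ[ℝ] ℝ :=
    { toFun := fun w => (1 / 2 : ℝ) * f (w.2 j)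
      map_add' := fun v w => by
        change (1 / 2 : ℝ) * f (v.2 j + w.2 j) = _
        rw [map_add, mul_add]
      map_smul' := fun c w => by
        change (1 / 2 : ℝ) * f (c • w.2 j) = _
        rw [map_smul, smul_eq_mul, smul_eq_mul, RingHom.id_apply]
        ring }
  have hφ : φ ∈ S.Lam := by
    refine ⟨0, Pi.single j ((1 / 2 : ℝ) • f), Pi.single j 1, fun k => ?_, fun k => ?_, ?_,
      fun w => ?_⟩
    · refine ContinuousLinearMap.opNorm_le_bound _ zero_le_one fun w => ?_
      rw [Pair.functional_apply, Pair.norm_def, one_mul]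
      by_cases hk : k = j
      · subst hk
        have h1 := f.le_of_opNorm_le hf w.2
        have h2 := S.norm_snd_le k w.1 w.2
        rw [Pi.single_eq_same, zero_apply, zero_add,
          smul_apply, norm_smul]
        have h3 : ‖(1 / 2 : ℝ)‖ = 1 / 2 := by norm_num
        rw [h3]
        change _ ≤ S.nrm k (w.1, w.2)
        linarith
      · rw [Pi.single_eq_of_ne hk]
        rw [zero_apply, zero_apply, add_zero, norm_zero]
        exact apply_nonneg (S.nrm k) w
    · by_cases hk : k = j
      · subst hk; simp
      · simp [Pi.single_eq_of_ne hk]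
    · have h : HasSum (fun k => (Pi.single j (1 : ℝ) : ℕ → ℝ) k ^ 2) 1 := by
        have h0 := hasSum_single (f := fun k => (Pi.single j (1 : ℝ) : ℕ → ℝ) k ^ 2) j
          (fun k hk => by simp [Pi.single_eq_of_ne hk])
        simpa using h0
      exact ⟨h.summable, h.tsum_eq.le⟩
    · have h0 := hasSum_single (f := fun k => (Pi.single j (1 : ℝ) : ℕ → ℝ) k *
        (Pi.single j ((1 / 2 : ℝ) • f) : ∀ k, StrongDual ℝ (Y k)) k (w.2 k)) j
          (fun k hk => by simp [Pi.single_eq_of_ne hk])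
      convert h0 using 1
      simp only [Pi.single_eq_same, one_mul, smul_apply, smul_eq_mul,
        zero_apply, sub_zero]
      rfl
  have h := Sigma.le_norm S z hφ
  have h' : φ z = (1 / 2 : ℝ) * ‖z.2 j‖ := by
    change (1 / 2 : ℝ) * f (z.2 j) = _
    rw [hfz]
    rfl
  rw [h', abs_of_nonneg (by positivity)] at h
  linarith

theorem Sigma.core (S : SumNorms X Y) : NormedSpace.Core ℝ S.Sigma where
  norm_nonneg z := (abs_nonneg _).trans (Sigma.le_norm S z S.zero_mem_Lam)
  norm_smul c z := by
    have key : ∀ (a : ℝ) (w : S.Sigma), ‖a • w‖ ≤ ‖a‖ * ‖w‖ := fun a w =>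
      Sigma.norm_le S _ fun φ hφ => by
        rw [map_smul, smul_eq_mul, abs_mul, Real.norm_eq_abs]
        exact mul_le_mul_of_nonneg_left (Sigma.le_norm S w hφ) (abs_nonneg a)
    refine le_antisymm (key c z) ?_
    by_cases hc : c = 0
    · subst hc
      rw [norm_zero, zero_mul]
      exact (abs_nonneg _).trans (Sigma.le_norm S _ S.zero_mem_Lam)
    · have h := key c⁻¹ (c • z)
      rw [inv_smul_smul₀ hc, norm_inv] at h
      have hc' : 0 < ‖c‖ := norm_pos_iff.2 hc
      rwa [inv_mul_eq_div, le_div_iff₀ hc', mul_comm] at h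
  norm_triangle z w := Sigma.norm_le S _ fun φ hφ => by
    rw [map_add]
    exact (abs_add_le _ _).trans (add_le_add (Sigma.le_norm S z hφ) (Sigma.le_norm S w hφ))
  norm_eq_zero_iff z := by
    constructor
    · intro h
      have h1 := Sigma.norm_fst_le S z
      rw [h] at h1
      have hx : z.1 = 0 := norm_le_zero_iff.1 h1
      have hy : z.2 = 0 := by
        ext j
        have h2 := Sigma.norm_snd_le S z j
        rw [h, mul_zero] at h2
        exact norm_le_zero_iff.1 h2
      exact Prod.ext hx hy
    · rintro rfl
      refine le_antisymm (Sigma.norm_le S _ fun φ _ => ?_)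
        ((abs_nonneg _).trans (Sigma.le_norm S _ S.zero_mem_Lam))
      rw [map_zero, abs_zero]

instance (S : SumNorms X Y) : NormedAddCommGroup S.Sigma :=
  NormedAddCommGroup.ofCore (Sigma.core S)

instance (S : SumNorms X Y) : NormedSpace ℝ S.Sigma :=
  NormedSpace.ofCore (Sigma.core S)

end SumNorms

end

open Filter Topology

/-! By Šmulian's criterion, a dual norm is differentiable at a functional once the almost norming
vectors of the unit ball converge in norm to a norming one. The proof establishes thin slices for
those ψ in Λ that take the value 1 on the unit ball, and then transfers this to an arbitrary φ ≠ 0.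

Transfer. A Fréchet smooth dual forces reflexivity
(`FrechetSmooth.exists_eq_inclusionInDoubleDual`), so X and all Y k are reflexive. The lower bound
with c makes the Y-components of the unit ball bounded in ℓ², so sequences in the ball have weak
limits along ultrafilters (`SumNorms.exists_weak_limit`). The supremum defining the norm is attained
on Λ (`exists_isLam_apply_eq_norm`). If unit ball vectors z and z' both norm φ, then ‖z + z'‖ = 2,
hence some ψ in Λ equals 1 at both. A maximizing sequence for φ that tends weakly to z' enters every
slice of ψ; such slices are small and contain z, so the sequence comes close to z.

Thin slices. For ψ = f + ∑ α k • g k it suffices to find, for each ε, a linear s with ‖ψ + h‖ ≤ 1 +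
s h + ε‖h‖ near 0; s may depend on ε. To get this, ψ + h is decomposed anew
(`IsLam.eventually_norm_add_le`). On a finite set K the coefficients become α k + e k h with ∑ α k *
e k h = 0, so that their square sum changes only to second order, while every pair norm has the same
derivative s. Off K the α k have tiny square sum, so multiplying them by 1 + C‖h‖ is almost free,
and it shrinks the Y-parts enough to keep the pair norms below 1 + s h + ε‖h‖. If ‖f‖ = 1, s is
evaluation at a vector norming f and e = 0. If ‖f‖ < 1, the conditions on s and e form a linear
system that is solved explicitly. -/

/-! ### Ekeland's variational principle -/

/-- Ekeland's variational principle for continuous functions bounded below. -/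
theorem ekeland {M : Type*} [MetricSpace M] [CompleteSpace M] [Nonempty M] {F : M → ℝ}
    (hF : Continuous F) {m : ℝ} (hm : ∀ x, m ≤ F x) {ε : ℝ} (hε : 0 < ε) :
    ∃ x₀, ∀ x, F x₀ ≤ F x + ε * dist x x₀ := by
  classical
  -- `x ∈ T y` is a partial order; a minimal element of it is the point sought.
  let T : M → Set M := fun y => {x | F x + ε * dist x y ≤ F y}
  have hself : ∀ y, y ∈ T y := fun y => by simp [T]
  have htrans : ∀ {x y w}, x ∈ T y → y ∈ T w → x ∈ T w := by
    intro x y w h1 h2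
    simp only [T, Set.mem_ofPred_eq] at *
    nlinarith [dist_triangle x y w]
  have hbdd : ∀ y, BddBelow (F '' T y) := fun y => ⟨m, by rintro _ ⟨x, -, rfl⟩; exact hm x⟩
  have hstep : ∀ (n : ℕ) (y : M), ∃ x ∈ T y, ∀ w ∈ T y, F x ≤ F w + (1 / 2) ^ n := by
    intro n y
    have hne : (F '' T y).Nonempty := ⟨_, y, hself y, rfl⟩
    obtain ⟨_, ⟨x, hx, rfl⟩, hlt⟩ := exists_lt_of_csInf_lt hne
      (lt_add_of_pos_right (sInf (F '' T y)) (show (0 : ℝ) < (1 / 2) ^ n by positivity))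
    exact ⟨x, hx, fun w hw => by linarith [csInf_le (hbdd y) ⟨w, hw, rfl⟩]⟩
  choose next hnext hnear using hstep
  let u : ℕ → M := fun n => Nat.rec (Classical.arbitrary M) (fun n y => next n y) n
  have hu : ∀ n, u (n + 1) = next n (u n) := fun n => rfl
  have hmem : ∀ n k, u (n + k) ∈ T (u n) := by
    intro n k
    induction k with
    | zero => exact hself _
    | succ k ih => exact htrans (by rw [← add_assoc, hu]; exact hnext _ _) ih
  have hclose : ∀ n x, x ∈ T (u (n + 1)) → ε * dist x (u (n + 1)) ≤ (1 / 2) ^ n := by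
    intro n x hx
    have h1 := hnear n (u n) x (htrans hx (hmem n 1))
    rw [← hu] at h1
    have h2 : F x + ε * dist x (u (n + 1)) ≤ F (u (n + 1)) := hx
    linarith
  have hlim0 : Tendsto (fun n : ℕ => (1 / 2 : ℝ) ^ n / ε) atTop (𝓝 0) := by
    simpa using (tendsto_pow_atTop_nhds_zero_of_lt_one (r := (1 / 2 : ℝ)) (by norm_num)
      (by norm_num)).div_const ε
  have hclose' : ∀ n x, x ∈ T (u (n + 1)) → dist x (u (n + 1)) ≤ (1 / 2) ^ n / ε := by
    intro n x hx
    rw [le_div_iff₀ hε, mul_comm]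
    exact hclose n x hx
  have hcauchy : CauchySeq (fun n => u (n + 1)) := by
    refine cauchySeq_of_le_tendsto_0' _ (fun n k hnk => ?_) hlim0
    obtain ⟨j, rfl⟩ := Nat.exists_eq_add_of_le hnk
    rw [dist_comm]
    refine hclose' n _ ?_
    have := hmem (n + 1) j
    rwa [show n + 1 + j = n + j + 1 by omega] at this
  obtain ⟨x₀, hx₀⟩ := cauchySeq_tendsto_of_complete hcauchy
  have hx₀T : ∀ n, x₀ ∈ T (u n) := by
    intro n
    have hcl : IsClosed (T (u n)) :=
      isClosed_le (hF.add (continuous_const.mul (continuous_id.dist continuous_const)))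
        continuous_const
    refine hcl.mem_of_tendsto hx₀ (eventually_atTop.2 ⟨n, fun k hk => ?_⟩)
    obtain ⟨j, rfl⟩ := Nat.exists_eq_add_of_le hk
    exact hmem n (j + 1)
  refine ⟨x₀, fun x => ?_⟩
  by_contra! hlt
  have hxT : x ∈ T x₀ := hlt.le
  have hx : Tendsto (fun n => u (n + 1)) atTop (𝓝 x) := by
    rw [tendsto_iff_dist_tendsto_zero]
    refine squeeze_zero (fun _ => dist_nonneg) (fun n => ?_) hlim0
    rw [dist_comm]
    exact hclose' n x (htrans hxT (hx₀T (n + 1)))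
  have : x = x₀ := tendsto_nhds_unique hx hx₀
  subst this
  simp at hlt

/-! ### Differentiable dual norms: reflexivity, weak limits and slices -/

theorem mem_closure_of_forall_norm_sub_le {G : Type*} [NormedAddCommGroup G] {A : Set G} {a : G}
    (h : ∀ ε > 0, ∃ b ∈ A, ‖b - a‖ ≤ ε) : a ∈ closure A := by
  refine Metric.mem_closure_iff.2 fun ε hε => ?_
  obtain ⟨b, hb, hba⟩ := h (ε / 2) (half_pos hε)
  refine ⟨b, hb, ?_⟩
  rw [dist_comm, dist_eq_norm]
  linarith

theorem LinearIsometry.isClosed_range_of_complete {E G : Type*} [NormedAddCommGroup E]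
    [NormedSpace ℝ E] [CompleteSpace E] [NormedAddCommGroup G] [NormedSpace ℝ G] (f : E →ₗᵢ[ℝ] G) :
    IsClosed (Set.range f) :=
  f.isometry.isClosedEmbedding.isClosed_range

section Dual

variable {E : Type*} [NormedAddCommGroup E] [NormedSpace ℝ E]

/-- If the dual norm is Fréchet differentiable at `F`, then almost norming points of the unit ball
are close to the derivative. -/
theorem norm_inclusion_sub_le_of_hasFDerivAt {F : StrongDual ℝ E}
    {D : StrongDual ℝ (StrongDual ℝ E)} (hD : HasFDerivAt (fun v : StrongDual ℝ E => ‖v‖) D F)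
    {ε : ℝ} (hε : 0 < ε) :
    ∃ δ > 0, ∀ x : E, ‖x‖ ≤ 1 → ‖F‖ - δ < F x →
      ‖NormedSpace.inclusionInDoubleDual ℝ E x - D‖ ≤ ε := by
  have h := hasFDerivAt_iff_isLittleO_nhds_zero.1 hD
  have h1 := h.def (show 0 < ε / 2 by positivity)
  obtain ⟨r, hr, hball⟩ := Metric.eventually_nhds_iff_ball.1 h1
  -- The slice width equals the differentiability error on the sphere of radius `r / 2`; the two add
  -- up to `ε * ‖g‖` there.
  refine ⟨ε / 2 * (r / 2), by positivity, fun x hx hFx => ?_⟩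
  have key : ∀ g : StrongDual ℝ E, ‖g‖ = r / 2 → (g x - D g) ≤ ε * ‖g‖ := by
    intro g hg
    have h2 := hball g (by rw [mem_ball_zero_iff, hg]; linarith)
    rw [Real.norm_eq_abs] at h2
    have h3 := (le_abs_self _).trans h2
    have h4 : (F + g) x ≤ ‖F + g‖ := by
      refine (le_abs_self _).trans (((F + g).le_opNorm x).trans ?_)
      exact mul_le_of_le_one_right (norm_nonneg _) hx
    rw [add_apply] at h4
    rw [hg] at h3 ⊢
    linarith
  have key' : ∀ g : StrongDual ℝ E, ‖g‖ = r / 2 → ‖g x - D g‖ ≤ ε * ‖g‖ := by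
    intro g hg
    rw [Real.norm_eq_abs, abs_le]
    have h1 := key g hg
    have h2 := key (-g) (by rw [norm_neg, hg])
    rw [norm_neg, map_neg, neg_apply] at h2
    constructor <;> linarith
  refine ContinuousLinearMap.opNorm_le_bound _ hε.le fun g => ?_
  rw [sub_apply, NormedSpace.dual_def]
  by_cases hg : g = 0
  · subst hg; simp
  have hg' : 0 < ‖g‖ := norm_pos_iff.2 hg
  have h5 := key' ((r / 2 / ‖g‖) • g) (by
    rw [norm_smul, Real.norm_of_nonneg (by positivity)]; field_simp)
  rw [map_smul, smul_apply, ← smul_sub, norm_smul, norm_smul,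
    Real.norm_of_nonneg (by positivity : 0 ≤ r / 2 / ‖g‖)] at h5
  have h6 : 0 < r / 2 / ‖g‖ := by positivity
  have h7 : r / 2 / ‖g‖ * ‖g x - D g‖ ≤ r / 2 / ‖g‖ * (ε * ‖g‖) := by linarith
  exact le_of_mul_le_mul_left h7 h6

theorem exists_almost_norming (F : StrongDual ℝ E) {δ : ℝ} (hδ : 0 < δ) :
    ∃ x : E, ‖x‖ ≤ 1 ∧ ‖F‖ - δ < F x := by
  obtain ⟨x, hx, hFx⟩ := F.exists_lt_apply_of_lt_opNorm (r := ‖F‖ - δ) (by linarith)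
  rcases le_total 0 (F x) with h | h
  · exact ⟨x, hx.le, by rwa [Real.norm_of_nonneg h] at hFx⟩
  · refine ⟨-x, by rw [norm_neg]; exact hx.le, ?_⟩
    rwa [Real.norm_of_nonpos h, ← map_neg] at hFx

theorem fderiv_norm_mem_closure {F : StrongDual ℝ E} {D : StrongDual ℝ (StrongDual ℝ E)}
    (hD : HasFDerivAt (fun v : StrongDual ℝ E => ‖v‖) D F) :
    D ∈ closure (Set.range (NormedSpace.inclusionInDoubleDual ℝ E)) := by
  refine mem_closure_of_forall_norm_sub_le (G := StrongDual ℝ (StrongDual ℝ E)) fun ε hε => ?_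
  obtain ⟨δ, hδ, h⟩ := norm_inclusion_sub_le_of_hasFDerivAt hD hε
  obtain ⟨x, hx, hFx⟩ := exists_almost_norming F hδ
  refine ⟨_, ⟨x, rfl⟩, ?_⟩
  exact h x hx hFx

theorem fderiv_norm_eq_of_norming {F : StrongDual ℝ E} {D : StrongDual ℝ (StrongDual ℝ E)}
    (hD : HasFDerivAt (fun v : StrongDual ℝ E => ‖v‖) D F) {x : E} (hx : ‖x‖ ≤ 1)
    (hF : F x = ‖F‖) (g : StrongDual ℝ E) : D g = g x := by
  have : NormedSpace.inclusionInDoubleDual ℝ E x = D := by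
    refine eq_of_sub_eq_zero ((norm_le_zero_iff (E := StrongDual ℝ (StrongDual ℝ E))).1 ?_)
    refine le_of_forall_pos_le_add fun ε hε => ?_
    obtain ⟨δ, hδ, h⟩ := norm_inclusion_sub_le_of_hasFDerivAt hD hε
    rw [zero_add]
    exact h x hx (by linarith)
  rw [← this, NormedSpace.dual_def]

/-- A Banach space with Fréchet smooth dual is reflexive. -/
theorem FrechetSmooth.exists_eq_inclusionInDoubleDual [CompleteSpace E]
    (h : FrechetSmooth (StrongDual ℝ E)) (Φ : StrongDual ℝ (StrongDual ℝ E)) :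
    ∃ x : E, ∀ f : StrongDual ℝ E, Φ f = f x := by
  have hclosed : IsClosed (Set.range (NormedSpace.inclusionInDoubleDual ℝ E)) :=
    LinearIsometry.isClosed_range_of_complete (G := StrongDual ℝ (StrongDual ℝ E))
      (NormedSpace.inclusionInDoubleDualLi ℝ)
  suffices hcl : Φ ∈ closure (Set.range (NormedSpace.inclusionInDoubleDual ℝ E)) by
    rw [hclosed.closure_eq] at hcl
    obtain ⟨x, rfl⟩ := hcl
    exact ⟨x, fun f => NormedSpace.dual_def ℝ E x f⟩
  have hderiv : ∀ f : StrongDual ℝ E, ∃ D ∈ Set.range (NormedSpace.inclusionInDoubleDual ℝ E),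
      HasFDerivAt (fun v : StrongDual ℝ E => ‖v‖ ^ 2) D f := by
    intro f
    by_cases hf : f = 0
    · subst hf
      refine ⟨0, ⟨0, map_zero _⟩, ?_⟩
      rw [hasFDerivAt_iff_isLittleO_nhds_zero]
      simp only [zero_add, norm_zero, zero_apply, sub_zero, ne_eq,
        OfNat.ofNat_ne_zero, not_false_eq_true, zero_pow]
      exact Asymptotics.isLittleO_norm_pow_id (by norm_num)
    · have hD := (h f hf).hasFDerivAt
      have hDm := fderiv_norm_mem_closure hD
      rw [hclosed.closure_eq] at hDm
      obtain ⟨x, hx⟩ := hDm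
      have h2 := hD.pow 2
      refine ⟨_, ⟨(2 * ‖f‖) • x, ?_⟩, h2⟩
      rw [map_smul, hx]
      simp
  refine mem_closure_of_forall_norm_sub_le (G := StrongDual ℝ (StrongDual ℝ E)) fun ε hε => ?_
  -- An almost minimum of ‖f‖² - Φ f is an almost critical point, so the derivative of ‖·‖² there,
  -- which lies in the image of E, is close to Φ.
  obtain ⟨f, hf⟩ := ekeland (F := fun f : StrongDual ℝ E => ‖f‖ ^ 2 - Φ f) (by fun_prop)
    (m := -‖Φ‖ ^ 2) (fun f => by
      have := (le_abs_self _).trans (Φ.le_opNorm f)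
      nlinarith [sq_nonneg (‖Φ‖ - ‖f‖), norm_nonneg Φ, norm_nonneg f]) (half_pos (half_pos hε))
  obtain ⟨D, hDm, hD⟩ := hderiv f
  refine ⟨D, hDm, ?_⟩
  have hle : ‖D - Φ‖ ≤ ε / 2 := by
    have hH := hasFDerivAt_iff_isLittleO_nhds_zero.1 (hD.sub Φ.hasFDerivAt)
    obtain ⟨r, hr, hball⟩ := Metric.eventually_nhds_iff_ball.1
      (hH.def (half_pos (half_pos hε)))
    have key : ∀ g : StrongDual ℝ E, g ∈ Metric.ball 0 r → -(D - Φ) g ≤ ε / 2 * ‖g‖ := by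
      intro g hg
      have h1 := (le_abs_self _).trans (hball g hg)
      have h2 := hf (f + g)
      rw [dist_eq_norm, add_sub_cancel_left] at h2
      simp only [Pi.sub_apply] at h1
      linarith
    have key' : ∀ g : StrongDual ℝ E, g ∈ Metric.ball 0 r → ‖(D - Φ) g‖ ≤ ε / 2 * ‖g‖ := by
      intro g hg
      have h1 := key g hg
      have h2 := key (-g) (by simpa using hg)
      rw [map_neg, norm_neg] at h2
      rw [Real.norm_eq_abs, abs_le]
      constructor <;> linarith
    exact ContinuousLinearMap.opNorm_le_of_ball hr (by positivity) key'
  linarith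

/-- Bounded families of functionals converge pointwise along ultrafilters. -/
theorem exists_pointwise_limit {ι : Type*} (U : Ultrafilter ι) (f : ι → StrongDual ℝ E) {R : ℝ}
    (hf : ∀ i, ‖f i‖ ≤ R) :
    ∃ g : StrongDual ℝ E, ‖g‖ ≤ R ∧ ∀ x, Tendsto (fun i => f i x) U (𝓝 (g x)) := by
  have hc := WeakDual.isCompact_closedBall (𝕜 := ℝ) (0 : StrongDual ℝ E) R
  obtain ⟨g, hg, hlim⟩ := hc.ultrafilter_le_nhds (U.map fun i => StrongDual.toWeakDual (f i)) (by
    rw [le_principal_iff]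
    refine Filter.mem_map.2 (Filter.univ_mem' fun i => ?_)
    simpa using hf i)
  refine ⟨WeakDual.toStrongDual g, by simpa using hg, fun x => ?_⟩
  exact ((WeakDual.eval_continuous x).tendsto g).comp hlim

theorem exists_weak_limit (hE : ∀ Φ : StrongDual ℝ (StrongDual ℝ E), ∃ x : E, ∀ f, Φ f = f x)
    {ι : Type*} (U : Ultrafilter ι) (u : ι → E) {R : ℝ} (hu : ∀ i, ‖u i‖ ≤ R) :
    ∃ x : E, ∀ f : StrongDual ℝ E, Tendsto (fun i => f (u i)) U (𝓝 (f x)) := by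
  obtain ⟨Φ, -, hΦ⟩ := exists_pointwise_limit U
    (fun i => NormedSpace.inclusionInDoubleDual ℝ E (u i)) (R := R)
    (fun i => (NormedSpace.double_dual_bound ℝ E (u i)).trans (hu i))
  obtain ⟨x, hx⟩ := hE Φ
  exact ⟨x, fun f => by simpa [NormedSpace.dual_def, hx] using hΦ f⟩

/-- Šmulian's criterion: if almost norming points of the unit ball converge to `z`, then the dual
norm is Fréchet differentiable. -/
theorem differentiableAt_norm_of_slices {φ : StrongDual ℝ E} {z : E} (hz : ‖z‖ ≤ 1)
    (hφz : φ z = ‖φ‖)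
    (h : ∀ ε > 0, ∃ δ > 0, ∀ w : E, ‖w‖ ≤ 1 → ‖φ‖ - δ < φ w → ‖w - z‖ ≤ ε) :
    DifferentiableAt ℝ (fun v : StrongDual ℝ E => ‖v‖) φ := by
  refine HasFDerivAt.differentiableAt (f' := NormedSpace.inclusionInDoubleDual ℝ E z) ?_
  rw [hasFDerivAt_iff_isLittleO_nhds_zero, Asymptotics.isLittleO_iff]
  intro ε hε
  obtain ⟨δ, hδ, hδw⟩ := h (ε / 2) (half_pos hε)
  -- A vector norming φ + g up to `ε / 2 * ‖g‖` norms φ up to `(2 + ε / 2) * ‖g‖`, hence lies in the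
  -- δ-slice of φ.
  refine Metric.eventually_nhds_iff_ball.2 ⟨δ / (2 + ε), by positivity, fun g hg => ?_⟩
  rw [mem_ball_zero_iff, lt_div_iff₀ (by positivity)] at hg
  rw [NormedSpace.dual_def]
  have hlow : ‖φ‖ + g z ≤ ‖φ + g‖ := by
    have h1 := (le_abs_self _).trans ((φ + g).le_opNorm z)
    rw [add_apply, hφz] at h1
    exact h1.trans (mul_le_of_le_one_right (norm_nonneg _) hz)
  rw [Real.norm_of_nonneg (by linarith)]
  by_cases hg0 : g = 0
  · subst hg0; simp
  have hgpos : 0 < ‖g‖ := norm_pos_iff.2 hg0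
  obtain ⟨w, hw, hwn⟩ := exists_almost_norming (φ + g) (show 0 < ε / 2 * ‖g‖ by positivity)
  rw [add_apply] at hwn
  have hφw : φ w ≤ ‖φ‖ := ((le_abs_self _).trans (φ.le_opNorm w)).trans
    (mul_le_of_le_one_right (norm_nonneg _) hw)
  have hgw : g w ≤ ‖g‖ := ((le_abs_self _).trans (g.le_opNorm w)).trans
    (mul_le_of_le_one_right (norm_nonneg _) hw)
  have htri : ‖φ‖ ≤ ‖φ + g‖ + ‖g‖ := by
    simpa using norm_sub_le (φ + g) g
  have hwz := hδw w hw (by nlinarith)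
  have h2 : g w - g z ≤ ε / 2 * ‖g‖ := by
    rw [← map_sub]
    refine ((le_abs_self _).trans (g.le_opNorm _)).trans ?_
    rw [mul_comm]
    exact mul_le_mul_of_nonneg_right hwz hgpos.le
  linarith

/-- Only an upper bound is needed: using +g at v and -g at w, with g norming v - w, the linear term
s cancels. Hence s may vary with ε. -/
theorem slices_shrink_of_norm_add_le {φ : StrongDual ℝ E}
    (h : ∀ ε > 0, ∃ s : StrongDual ℝ (StrongDual ℝ E),
      ∀ᶠ g in 𝓝 (0 : StrongDual ℝ E), ‖φ + g‖ ≤ 1 + s g + ε * ‖g‖) {ε : ℝ} (hε : 0 < ε) :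
    ∃ δ > 0, ∀ v w : E, ‖v‖ ≤ 1 → ‖w‖ ≤ 1 → 1 - δ < φ v → 1 - δ < φ w → ‖v - w‖ ≤ ε := by
  obtain ⟨s, hs⟩ := h (ε / 4) (by positivity)
  obtain ⟨r, hr, hball⟩ := Metric.eventually_nhds_iff_ball.1 hs
  refine ⟨ε / 4 * (r / 2), by positivity, fun v w hv hw hφv hφw => ?_⟩
  by_cases hvw : ‖v - w‖ = 0
  · rw [hvw]; exact hε.le
  obtain ⟨g, hg, hgvw⟩ := exists_dual_vector ℝ (v - w) hvw
  have hn : ‖(r / 2) • g‖ = r / 2 := by rw [norm_smul, hg, Real.norm_of_nonneg (by positivity), mul_one]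
  have h1 := hball ((r / 2) • g) (by rw [mem_ball_zero_iff, hn]; linarith)
  have h2 := hball (-((r / 2) • g)) (by rw [mem_ball_zero_iff, norm_neg, hn]; linarith)
  have h3 := ((le_abs_self _).trans ((φ + (r / 2) • g).le_opNorm v)).trans
    (mul_le_of_le_one_right (norm_nonneg _) hv)
  have h4 := ((le_abs_self _).trans ((φ + -((r / 2) • g)).le_opNorm w)).trans
    (mul_le_of_le_one_right (norm_nonneg _) hw)
  rw [map_neg, norm_neg, hn] at h2
  rw [hn] at h1
  simp only [add_apply, neg_apply,
    smul_apply, smul_eq_mul] at h3 h4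
  rw [map_sub] at hgvw
  have h5 : g v - g w = ‖v - w‖ := hgvw
  have h6 : r / 2 * ‖v - w‖ ≤ r / 2 * ε := by rw [← h5]; linarith
  exact le_of_mul_le_mul_left h6 (by positivity)

end Dual

/-! ### Elementary square sum inequalities -/

theorem abs_le_of_hasSum {a : ℕ → ℝ} {t R : ℝ} (ha : HasSum a t)
    (h : ∀ s : Finset ℕ, |∑ k ∈ s, a k| ≤ R) : |t| ≤ R :=
  le_of_tendsto (continuous_abs.tendsto t |>.comp ha) (Eventually.of_forall h)

theorem sum_mul_le_of_sq_le (s : Finset ℕ) {a b : ℕ → ℝ} {A B : ℝ} (hA : 0 ≤ A) (hB : 0 ≤ B)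
    (ha : ∑ k ∈ s, a k ^ 2 ≤ A ^ 2) (hb : ∑ k ∈ s, b k ^ 2 ≤ B ^ 2) :
    ∑ k ∈ s, a k * b k ≤ A * B :=
  (Real.sum_mul_le_sqrt_mul_sqrt s a b).trans
    (mul_le_mul (Real.sqrt_le_iff.2 ⟨hA, ha⟩) (Real.sqrt_le_iff.2 ⟨hB, hb⟩)
      (Real.sqrt_nonneg _) hA)

theorem lp.sum_norm_sq_le {G : ℕ → Type*} [∀ k, NormedAddCommGroup (G k)] (y : lp G 2) (s : Finset ℕ) : ∑ k ∈ s, ‖y k‖ ^ 2 ≤ ‖y‖ ^ 2 := by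
  have h := lp.sum_rpow_le_norm_rpow (p := 2) (by norm_num) y s
  simpa using h

/-! ### Coordinates of functionals on the ℓ²-sum and norm bounds from decompositions -/

namespace SumNorms

noncomputable section

variable {X : Type*} [NormedAddCommGroup X] [NormedSpace ℝ X]
  {Y : ℕ → Type*} [∀ k, NormedAddCommGroup (Y k)] [∀ k, NormedSpace ℝ (Y k)] (S : SumNorms X Y)

theorem Sigma.norm_inr_le (y : lp Y 2) : ‖(show S.Sigma from (0, y))‖ ≤ ‖y‖ := by
  refine Sigma.norm_le S _ fun φ hφ => ?_
  obtain ⟨f, g, α, h1, h2, ⟨h3, h4⟩, h5⟩ := hφ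
  have h6 := h5 (0, y)
  have h7 : φ (0, y) - f 0 = φ (0, y) := by rw [map_zero, sub_zero]
  change HasSum (fun k => α k * g k (y k)) (φ (0, y) - f 0) at h6
  rw [h7] at h6
  refine abs_le_of_hasSum h6 fun s => ?_
  calc |∑ k ∈ s, α k * g k (y k)| ≤ ∑ k ∈ s, |α k * g k (y k)| := Finset.abs_sum_le_sum_abs _ _
    _ ≤ ∑ k ∈ s, α k * ‖y k‖ := Finset.sum_le_sum fun k _ => by
        rw [abs_mul, abs_of_nonneg (h2 k).1]
        exact mul_le_mul_of_nonneg_left (S.abs_right_le k (h1 k) (y k)) (h2 k).1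
    _ ≤ 1 * ‖y‖ := sum_mul_le_of_sq_le s zero_le_one (norm_nonneg _)
        (by rw [one_pow]; exact (h3.sum_le_tsum s fun k _ => sq_nonneg _).trans h4)
        (lp.sum_norm_sq_le y s)
    _ = ‖y‖ := one_mul _

theorem Sigma.norm_inl_le (x : X) : ‖(show S.Sigma from (x, 0))‖ ≤ ‖x‖ := by
  refine Sigma.norm_le S _ fun φ hφ => ?_
  obtain ⟨f, g, α, h1, h2, ⟨h3, h4⟩, h5⟩ := hφ
  have h6 := h5 (x, 0)
  change HasSum (fun k => α k * g k 0) (φ (x, 0) - f x) at h6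
  simp only [map_zero, mul_zero] at h6
  have h7 : φ (x, 0) = f x := by
    have := h6.unique hasSum_zero
    linarith
  rw [h7]
  exact S.abs_left_le 0 (h1 0) x

/-- The inclusion of `X` into the generalized `ℓ²`-sum. -/
def Sigma.inl : X →L[ℝ] S.Sigma :=
  LinearMap.mkContinuous (LinearMap.inl ℝ X (lp Y 2) : X →ₗ[ℝ] S.Sigma) 1
    (fun x => by rw [one_mul]; exact Sigma.norm_inl_le S x)

/-- The inclusion of the `ℓ²`-sum of the `Y k` into the generalized `ℓ²`-sum. -/
def Sigma.inr : lp Y 2 →L[ℝ] S.Sigma :=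
  LinearMap.mkContinuous (LinearMap.inr ℝ X (lp Y 2) : lp Y 2 →ₗ[ℝ] S.Sigma) 1
    (fun y => by rw [one_mul]; exact Sigma.norm_inr_le S y)

/-- The inclusion of `Y k` into the generalized `ℓ²`-sum. -/
def Sigma.single (k : ℕ) : Y k →L[ℝ] S.Sigma :=
  (Sigma.inr S).comp (lp.singleContinuousLinearMap ℝ Y 2 k)

/-- The projection of the generalized `ℓ²`-sum onto `X`. -/
def Sigma.fst : S.Sigma →L[ℝ] X :=
  LinearMap.mkContinuous (LinearMap.fst ℝ X (lp Y 2) : S.Sigma →ₗ[ℝ] X) 1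
    (fun z => by rw [one_mul]; exact Sigma.norm_fst_le S z)

/-- The projection of the generalized `ℓ²`-sum onto `Y k`. -/
def Sigma.proj (k : ℕ) : S.Sigma →L[ℝ] Y k :=
  LinearMap.mkContinuous
    { toFun := fun w => w.2 k
      map_add' := fun _ _ => rfl
      map_smul' := fun _ _ => rfl } 2 (fun z => Sigma.norm_snd_le S z k)

theorem Sigma.single_apply (k : ℕ) (y : Y k) : Sigma.single S k y = (0, lp.single 2 k y) := rfl

theorem Sigma.norm_single_le (k : ℕ) (y : Y k) : ‖Sigma.single S k y‖ ≤ ‖y‖ := by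
  rw [Sigma.single_apply]
  refine (Sigma.norm_inr_le S _).trans ?_
  rw [lp.norm_single (by norm_num)]

theorem Sigma.inl_add_inr (w : S.Sigma) : Sigma.inl S w.1 + Sigma.inr S w.2 = w :=
  Prod.ext (add_zero _) (zero_add _)

/-- The restriction of functionals to `X`. -/
def left : StrongDual ℝ S.Sigma →L[ℝ] StrongDual ℝ X :=
  ContinuousLinearMap.precomp ℝ (Sigma.inl S)

/-- The restriction of functionals to `Y k`. -/
def coord (k : ℕ) : StrongDual ℝ S.Sigma →L[ℝ] StrongDual ℝ (Y k) :=
  ContinuousLinearMap.precomp ℝ (Sigma.single S k)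

theorem left_apply (φ : StrongDual ℝ S.Sigma) (x : X) : S.left φ x = φ (Sigma.inl S x) := rfl

theorem coord_apply (φ : StrongDual ℝ S.Sigma) (k : ℕ) (y : Y k) :
    S.coord k φ y = φ (Sigma.single S k y) := rfl

theorem hasSum_coord (φ : StrongDual ℝ S.Sigma) (w : S.Sigma) :
    HasSum (fun k => S.coord k φ (w.2 k)) (φ w - S.left φ w.1) := by
  have h := (lp.hasSum_single (p := 2) (by norm_num) w.2).mapL (φ.comp (Sigma.inr S))
  have h1 : φ w - S.left φ w.1 = φ (Sigma.inr S w.2) := by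
    rw [left_apply, ← map_sub]
    congr 1
    rw [sub_eq_iff_eq_add', Sigma.inl_add_inr]
  rw [h1]
  exact h

theorem norm_left_le (φ : StrongDual ℝ S.Sigma) : ‖S.left φ‖ ≤ ‖φ‖ :=
  ContinuousLinearMap.opNorm_le_bound _ (norm_nonneg _) fun x => by
    rw [left_apply]
    exact (φ.le_opNorm _).trans
      (mul_le_mul_of_nonneg_left (Sigma.norm_inl_le S x) (norm_nonneg _))

/-- Duality of ℓ² with itself: test φ on the vector whose k-th entry almost norms the k-th
coordinate and has length at most `‖S.coord k φ‖`. The factor 2 pays for "almost". -/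
theorem sum_norm_coord_sq_le (φ : StrongDual ℝ S.Sigma) (s : Finset ℕ) :
    ∑ k ∈ s, ‖S.coord k φ‖ ^ 2 ≤ (2 * ‖φ‖) ^ 2 := by
  have hex : ∀ k, ∃ u : Y k, ‖u‖ ≤ 1 ∧ ‖S.coord k φ‖ ≤ 2 * S.coord k φ u := by
    intro k
    by_cases h0 : S.coord k φ = 0
    · exact ⟨0, by simp, by simp [h0]⟩
    · obtain ⟨u, hu, h⟩ := exists_almost_norming (S.coord k φ) (half_pos (norm_pos_iff.2 h0))
      exact ⟨u, hu, by linarith⟩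
  choose u hu hφu using hex
  set T := ∑ k ∈ s, ‖S.coord k φ‖ ^ 2 with hT
  have hT0 : 0 ≤ T := Finset.sum_nonneg fun k _ => sq_nonneg _
  set y : lp Y 2 := ∑ k ∈ s, lp.single 2 k (‖S.coord k φ‖ • u k) with hy
  have hny : ‖y‖ ≤ √T := by
    refine Real.le_sqrt_of_sq_le ?_
    have h := lp.norm_sum_single (p := 2) (by norm_num) (fun k => ‖S.coord k φ‖ • u k) s
    simp only [ENNReal.toReal_ofNat, Real.rpow_ofNat] at h
    rw [hy, h, hT]
    refine Finset.sum_le_sum fun k _ => ?_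
    rw [norm_smul, norm_norm, mul_pow]
    exact mul_le_of_le_one_right (sq_nonneg _) (pow_le_one₀ (norm_nonneg _) (hu k))
  have h1 : T ≤ 2 * φ (Sigma.inr S y) := by
    rw [hy, map_sum, map_sum, Finset.mul_sum, hT]
    refine Finset.sum_le_sum fun k _ => ?_
    have h2 : φ (Sigma.inr S (lp.single 2 k (‖S.coord k φ‖ • u k))) =
        ‖S.coord k φ‖ * S.coord k φ (u k) := by
      change S.coord k φ (‖S.coord k φ‖ • u k) = _
      rw [map_smul, smul_eq_mul]
    rw [h2, sq]
    nlinarith [hφu k, norm_nonneg (S.coord k φ)]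
  have h2 : φ (Sigma.inr S y) ≤ ‖φ‖ * √T :=
    ((le_abs_self _).trans (φ.le_opNorm _)).trans (mul_le_mul_of_nonneg_left
      ((Sigma.norm_inr_le S y).trans hny) (norm_nonneg _))
  have h3 := Real.sq_sqrt hT0
  have h4 : √T ≤ 2 * ‖φ‖ := by
    by_contra! hlt
    have : 0 < √T := lt_of_le_of_lt (by positivity) hlt
    nlinarith
  rw [← h3]
  exact pow_le_pow_left₀ (Real.sqrt_nonneg _) h4 2

/-- `S.IsLam φ f g α` says that `φ = f + ∑ k, α k • g k` is an element of `S.Lam`. -/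
structure IsLam (φ : StrongDual ℝ S.Sigma) (f : StrongDual ℝ X) (g : ∀ k, StrongDual ℝ (Y k))
    (α : ℕ → ℝ) : Prop where
  left_eq : S.left φ = f
  coord_eq : ∀ k, S.coord k φ = α k • g k
  norm_le : ∀ k, ‖Pair.functional S k f (g k)‖ ≤ 1
  nonneg : ∀ k, 0 ≤ α k
  sum_sq_le : ∀ s : Finset ℕ, ∑ k ∈ s, α k ^ 2 ≤ 1

variable {S}

theorem IsLam.mem_Lam {φ : StrongDual ℝ S.Sigma} {f : StrongDual ℝ X}
    {g : ∀ k, StrongDual ℝ (Y k)} {α : ℕ → ℝ} (h : S.IsLam φ f g α) :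
    (φ : S.Sigma →ₗ[ℝ] ℝ) ∈ S.Lam := by
  refine ⟨f, g, α, h.norm_le, fun k => ⟨h.nonneg k, ?_⟩, ⟨?_, ?_⟩, fun z => ?_⟩
  · have := h.sum_sq_le {k}
    rw [Finset.sum_singleton] at this
    nlinarith [h.nonneg k]
  · exact summable_of_sum_le (fun k => sq_nonneg _) h.sum_sq_le
  · exact Real.tsum_le_of_sum_le (fun k => sq_nonneg _) h.sum_sq_le
  · have h1 := S.hasSum_coord φ z
    rw [h.left_eq] at h1
    simp only [h.coord_eq, smul_apply, smul_eq_mul] at h1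
    exact h1

theorem IsLam.abs_apply_le {φ : StrongDual ℝ S.Sigma} {f : StrongDual ℝ X}
    {g : ∀ k, StrongDual ℝ (Y k)} {α : ℕ → ℝ} (h : S.IsLam φ f g α) (z : S.Sigma) :
    |φ z| ≤ ‖z‖ := Sigma.le_norm S z h.mem_Lam

theorem IsLam.neg {φ : StrongDual ℝ S.Sigma} {f : StrongDual ℝ X}
    {g : ∀ k, StrongDual ℝ (Y k)} {α : ℕ → ℝ} (h : S.IsLam φ f g α) :
    S.IsLam (-φ) (-f) (fun k => -g k) α where
  left_eq := by rw [map_neg, h.left_eq]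
  coord_eq k := by rw [map_neg, h.coord_eq, smul_neg]
  norm_le k := by
    have : Pair.functional S k (-f) (-g k) = -Pair.functional S k f (g k) := by
      ext z
      simp only [Pair.functional_apply, neg_apply]
      ring
    rw [this, norm_neg]
    exact h.norm_le k
  nonneg := h.nonneg
  sum_sq_le := h.sum_sq_le

theorem exists_isLam_of_mem_Lam {φ : S.Sigma →ₗ[ℝ] ℝ} (hφ : φ ∈ S.Lam) :
    ∃ (ψ : StrongDual ℝ S.Sigma) (f : StrongDual ℝ X) (g : ∀ k, StrongDual ℝ (Y k)) (α : ℕ → ℝ),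
      (∀ z, ψ z = φ z) ∧ ‖ψ‖ ≤ 1 ∧ S.IsLam ψ f g α := by
  have hφ' := hφ
  obtain ⟨f, g, α, h1, h2, ⟨h3, h4⟩, h5⟩ := hφ
  let ψ : StrongDual ℝ S.Sigma := LinearMap.mkContinuous φ 1
    (fun z => by rw [one_mul]; exact Sigma.le_norm S z hφ')
  refine ⟨ψ, f, g, α, fun _ => rfl, LinearMap.mkContinuous_norm_le _ zero_le_one _,
    ⟨?_, fun k => ?_, h1, fun k => (h2 k).1,
      fun s => (h3.sum_le_tsum s fun k _ => sq_nonneg _).trans h4⟩⟩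
  · ext x
    have h6 := h5 (x, 0)
    change HasSum (fun k => α k * g k 0) (φ (x, 0) - f x) at h6
    simp only [map_zero, mul_zero] at h6
    have := h6.unique hasSum_zero
    change φ (x, 0) = f x
    linarith
  · ext y
    have h6 := h5 (0, lp.single 2 k y)
    change HasSum (fun j => α j * g j (lp.single 2 k y j)) (φ (0, lp.single 2 k y) - f 0) at h6
    rw [map_zero, sub_zero] at h6
    have h7 := hasSum_single (f := fun j => α j * g j (lp.single 2 k y j)) k (fun j hj => by
      rw [lp.single_apply_ne _ _ _ hj, map_zero, mul_zero])
    change φ (0, lp.single 2 k y) = α k * g k y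
    rw [h6.unique h7, lp.single_apply_self]

variable (S)

theorem Pair.functional_add (k : ℕ) (f f' : StrongDual ℝ X) (g g' : StrongDual ℝ (Y k)) :
    Pair.functional S k (f + f') (g + g') =
      Pair.functional S k f g + Pair.functional S k f' g' := by
  ext z
  simp only [Pair.functional_apply, add_apply]
  ring

theorem Pair.functional_smul (k : ℕ) (a : ℝ) (f : StrongDual ℝ X) (g : StrongDual ℝ (Y k)) :
    Pair.functional S k (a • f) (a • g) = a • Pair.functional S k f g := by
  ext z
  simp only [Pair.functional_apply, smul_apply, smul_eq_mul]
  ring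

theorem norm_le_norm_functional (k : ℕ) (f : StrongDual ℝ X) (g : StrongDual ℝ (Y k)) :
    ‖f‖ ≤ ‖Pair.functional S k f g‖ := by
  refine ContinuousLinearMap.opNorm_le_bound _ (norm_nonneg _) fun x => ?_
  have h := (Pair.functional S k f g).le_opNorm (show S.Pair k from (x, 0))
  rw [Pair.functional_apply, Pair.norm_def] at h
  change ‖f x + g 0‖ ≤ _ * S.nrm k (x, 0) at h
  rwa [S.nrm_left, map_zero, add_zero] at h

theorem norm_functional_zero_right (k : ℕ) (f : StrongDual ℝ X) :
    ‖Pair.functional S k f 0‖ = ‖f‖ := by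
  refine le_antisymm ?_ (norm_le_norm_functional S k f 0)
  refine ContinuousLinearMap.opNorm_le_bound _ (norm_nonneg _) fun z => ?_
  rw [Pair.functional_apply, zero_apply, add_zero]
  exact (f.le_opNorm _).trans (mul_le_mul_of_nonneg_left (S.nrm_mono k z.1 z.2) (norm_nonneg _))

/-- The dual form of the lower bound: the dual ball of the pair contains the product of the unit
ball of X* and the c-ball of Y*. -/
theorem norm_functional_le_one {c : ℝ} {k : ℕ}
    (hlower : ∀ (x : X) (y : Y k), ‖x‖ + c * ‖y‖ ≤ S.nrm k (x, y))
    {f : StrongDual ℝ X} {g : StrongDual ℝ (Y k)} (hf : ‖f‖ ≤ 1) (hg : ‖g‖ ≤ c) :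
    ‖Pair.functional S k f g‖ ≤ 1 := by
  refine ContinuousLinearMap.opNorm_le_bound _ zero_le_one fun z => ?_
  rw [Pair.functional_apply, one_mul]
  refine (norm_add_le _ _).trans (le_trans (add_le_add ?_ ?_) (hlower z.1 z.2))
  · simpa using f.le_of_opNorm_le hf z.1
  · exact g.le_of_opNorm_le hg z.2

/-- With B = √M, dividing φ by R and its Y-part also by B gives ψ in Λ. Undoing this costs a
multiple of the X-part: φ = B R ψ - (B - 1) f, so the norm is at most (2B - 1) R ≤ B² R. -/
theorem norm_le_of_decomposition {φ : StrongDual ℝ S.Sigma} {g : ∀ k, StrongDual ℝ (Y k)}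
    {β : ℕ → ℝ} {R M : ℝ} (hM : 1 ≤ M) (hR : 0 < R) (hβ : ∀ k, 0 ≤ β k)
    (hβs : ∀ s : Finset ℕ, ∑ k ∈ s, β k ^ 2 ≤ M) (hφ : ∀ k, S.coord k φ = β k • g k)
    (hg : ∀ k, ‖Pair.functional S k (S.left φ) (g k)‖ ≤ R) : ‖φ‖ ≤ M * R := by
  have hM0 : 0 < M := by linarith
  have hB : 1 ≤ √M := Real.one_le_sqrt.2 hM
  have hBM : √M ^ 2 = M := Real.sq_sqrt hM0.le
  set B := √M with hBdef
  have hB0 : 0 < B := by linarith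
  have hf : ‖S.left φ‖ ≤ R := (norm_le_norm_functional S 0 _ _).trans (hg 0)
  let p : StrongDual ℝ S.Sigma := φ - (S.left φ).comp (Sigma.fst S)
  have hp : ∀ w, p w = φ w - S.left φ w.1 := fun w => rfl
  let ψ : StrongDual ℝ S.Sigma := R⁻¹ • (φ - (1 - B⁻¹) • p)
  have hψ : ∀ w, ψ w = R⁻¹ * (φ w - (1 - B⁻¹) * (φ w - S.left φ w.1)) := fun w => rfl
  have hlam : S.IsLam ψ (R⁻¹ • S.left φ) (fun k => R⁻¹ • g k) (fun k => B⁻¹ * β k) := by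
    refine ⟨?_, fun k => ?_, fun k => ?_, fun k => ?_, fun s => ?_⟩
    · ext x
      change R⁻¹ * (φ (Sigma.inl S x) - (1 - B⁻¹) * (φ (Sigma.inl S x) - φ (Sigma.inl S x))) =
        R⁻¹ * φ (Sigma.inl S x)
      ring
    · ext y
      have h0 : φ (Sigma.single S k y) = β k * g k y := by
        rw [← coord_apply, hφ]; rfl
      rw [coord_apply, hψ, h0]
      have h1 : S.left φ (Sigma.single S k y).1 = 0 := map_zero (S.left φ)
      rw [h1, smul_apply, smul_apply, smul_eq_mul, smul_eq_mul]
      ring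
    · rw [Pair.functional_smul, norm_smul, norm_inv, Real.norm_of_nonneg hR.le,
        inv_mul_le_one₀ hR]
      exact hg k
    · exact mul_nonneg (inv_nonneg.2 hB0.le) (hβ k)
    · simp only [mul_pow]
      rw [← Finset.mul_sum, inv_pow, hBM, inv_mul_le_one₀ hM0]
      exact hβs s
  refine ContinuousLinearMap.opNorm_le_bound _ (by positivity) fun w => ?_
  have h1 := hlam.abs_apply_le w
  have h2 : φ w = B * R * ψ w - (B - 1) * S.left φ w.1 := by
    rw [hψ]
    field_simp
    ring
  have h3 : |S.left φ w.1| ≤ R * ‖w‖ :=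
    ((S.left φ).le_of_opNorm_le hf w.1).trans
      (mul_le_mul_of_nonneg_left (Sigma.norm_fst_le S w) hR.le)
  rw [h2, Real.norm_eq_abs]
  calc |B * R * ψ w - (B - 1) * S.left φ w.1|
      ≤ |B * R * ψ w| + |(B - 1) * S.left φ w.1| := abs_sub _ _
    _ = B * R * |ψ w| + (B - 1) * |S.left φ w.1| := by
        rw [abs_mul, abs_mul (B - 1), abs_of_nonneg (by positivity : 0 ≤ B * R),
          abs_of_nonneg (by linarith : 0 ≤ B - 1)]
    _ ≤ B * R * ‖w‖ + (B - 1) * (R * ‖w‖) := add_le_add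
        (mul_le_mul_of_nonneg_left h1 (by positivity))
        (mul_le_mul_of_nonneg_left h3 (by linarith))
    _ = (2 * B - 1) * (R * ‖w‖) := by ring
    _ ≤ M * (R * ‖w‖) := mul_le_mul_of_nonneg_right (by nlinarith [sq_nonneg (B - 1)])
        (by positivity)
    _ = M * R * ‖w‖ := by ring

/-- Functionals with X-part 0 and g k of norm at most c are admissible in Λ, so the Σ-norm dominates
c times the ℓ²-norm of the Y-part. -/
theorem sum_norm_snd_sq_le {c : ℝ} (hc : 0 < c)
    (hlower : ∀ k (x : X) (y : Y k), ‖x‖ + c * ‖y‖ ≤ S.nrm k (x, y)) (w : S.Sigma)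
    (s : Finset ℕ) : ∑ k ∈ s, ‖w.2 k‖ ^ 2 ≤ (‖w‖ / c) ^ 2 := by
  set T := ∑ k ∈ s, ‖w.2 k‖ ^ 2 with hT
  have hT0 : 0 ≤ T := Finset.sum_nonneg fun k _ => sq_nonneg _
  rcases hT0.eq_or_lt with h0 | hpos
  · rw [← h0]; positivity
  have hex : ∀ k, ∃ g : StrongDual ℝ (Y k), ‖g‖ ≤ 1 ∧ g (w.2 k) = ‖w.2 k‖ := fun k =>
    exists_dual_vector'' ℝ (w.2 k)
  choose g hg hgw using hex
  have hsq := Real.sq_sqrt hT0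
  have hs0 : 0 < √T := Real.sqrt_pos.2 hpos
  let φ : StrongDual ℝ S.Sigma :=
    ∑ k ∈ s, (‖w.2 k‖ / √T) • (c • g k).comp (Sigma.proj S k)
  have hφ : ∀ v : S.Sigma, φ v = ∑ k ∈ s, ‖w.2 k‖ / √T * (c * g k (v.2 k)) := fun v => by
    simp only [φ, sum_apply]
    rfl
  have hcomp : S.left φ = 0 := by
    ext x
    rw [left_apply, hφ]
    refine Finset.sum_eq_zero fun k _ => ?_
    have : g k ((Sigma.inl S x).2 k) = 0 := map_zero (g k)
    rw [this, mul_zero, mul_zero]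
  have hle : ‖φ‖ ≤ 1 * 1 := by
    refine S.norm_le_of_decomposition (g := fun k => c • g k)
      (β := fun k => if k ∈ s then ‖w.2 k‖ / √T else 0) le_rfl one_pos (fun k => ?_)
      (fun t => ?_) (fun k => ?_) (fun k => ?_)
    · split_ifs <;> positivity
    · have h1 : ∀ k, (if k ∈ s then ‖w.2 k‖ / √T else 0) ^ 2 =
          if k ∈ s then ‖w.2 k‖ ^ 2 / T else 0 := fun k => by
        split_ifs
        · rw [div_pow, hsq]
        · norm_num
      simp only [h1]
      rw [Finset.sum_ite_mem, ← Finset.sum_div, div_le_one hpos]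
      exact Finset.sum_le_sum_of_subset_of_nonneg Finset.inter_subset_right
        fun k _ _ => sq_nonneg _
    · ext y
      rw [coord_apply, hφ]
      change ∑ j ∈ s, ‖w.2 j‖ / √T * (c * g j (lp.single 2 k y j)) = _
      rw [smul_apply, smul_apply, smul_eq_mul, smul_eq_mul]
      have h1 : ∀ j ∈ s, j ≠ k → ‖w.2 j‖ / √T * (c * g j (lp.single 2 k y j)) = 0 :=
        fun j _ hj => by rw [lp.single_apply_ne _ _ _ hj, map_zero, mul_zero, mul_zero]
      by_cases hk : k ∈ s
      · rw [Finset.sum_eq_single_of_mem k hk h1, if_pos hk, lp.single_apply_self]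
      · rw [if_neg hk, zero_mul]
        exact Finset.sum_eq_zero fun j hj => h1 j hj (fun h => hk (h ▸ hj))
    · rw [hcomp]
      refine S.norm_functional_le_one (hlower k) (by simp) ?_
      rw [norm_smul, Real.norm_of_nonneg hc.le]
      exact mul_le_of_le_one_right hc.le (hg k)
  have h1 : φ w = c * √T := by
    rw [hφ]
    have : ∀ k ∈ s, ‖w.2 k‖ / √T * (c * g k (w.2 k)) = c / √T * ‖w.2 k‖ ^ 2 := fun k _ => by
      rw [hgw]
      ring
    rw [Finset.sum_congr rfl this, ← Finset.mul_sum, ← hT]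
    nth_rw 2 [← hsq]
    field_simp
  have h2 := (le_abs_self _).trans (φ.le_of_opNorm_le hle w)
  rw [h1] at h2
  rw [← hsq]
  refine pow_le_pow_left₀ hs0.le ?_ 2
  rw [le_div_iff₀ hc]
  linarith

end

end SumNorms

/-! ### Square sums of perturbed coefficients -/

theorem sum_add_sq_le (s : Finset ℕ) {a b : ℕ → ℝ} {A B : ℝ} (hA : 0 ≤ A) (hB : 0 ≤ B)
    (ha : ∑ k ∈ s, a k ^ 2 ≤ A ^ 2) (hb : ∑ k ∈ s, b k ^ 2 ≤ B ^ 2) :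
    ∑ k ∈ s, (a k + b k) ^ 2 ≤ ∑ k ∈ s, a k ^ 2 + 2 * (A * B) + B ^ 2 := by
  have h1 : ∑ k ∈ s, (a k + b k) ^ 2 =
      ∑ k ∈ s, a k ^ 2 + 2 * ∑ k ∈ s, a k * b k + ∑ k ∈ s, b k ^ 2 := by
    rw [Finset.mul_sum, ← Finset.sum_add_distrib, ← Finset.sum_add_distrib]
    exact Finset.sum_congr rfl fun k _ => by ring
  rw [h1]
  have := sum_mul_le_of_sq_le s hA hB ha hb
  linarith

/-- Applied on K: orthogonality of the perturbation to α removes the first order term. -/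
theorem sum_add_sq_le_of_sum_mul_eq_zero (K : Finset ℕ) {a b : ℕ → ℝ} {A ε H : ℝ}
    (hab : ∑ k ∈ K, a k * b k = 0) (hH : 0 ≤ H) (hb : ∑ k ∈ K, b k ^ 2 ≤ A * H ^ 2)
    (hA : A * H ≤ ε) : ∑ k ∈ K, (a k + b k) ^ 2 ≤ ∑ k ∈ K, a k ^ 2 + ε * H := by
  have hexp : ∑ k ∈ K, (a k + b k) ^ 2 =
      ∑ k ∈ K, a k ^ 2 + 2 * ∑ k ∈ K, a k * b k + ∑ k ∈ K, b k ^ 2 := by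
    rw [Finset.mul_sum, ← Finset.sum_add_distrib, ← Finset.sum_add_distrib]
    exact Finset.sum_congr rfl fun k _ => by ring
  rw [hexp, hab, mul_zero, add_zero]
  have := mul_le_mul_of_nonneg_right hA hH
  linarith

/-- Applied off K. The additive perturbation costs 2εH, at most doubled by the factor (1 + CH)²;
enlarging the old coefficients costs 2εH + εH because their square sum is at most τ². Total: 7εH. -/
theorem sum_mul_add_sq_le (t : Finset ℕ) {a b : ℕ → ℝ} {c ε C τ H : ℝ} (hc : 0 < c)
    (hε : 0 ≤ ε) (hC : 0 ≤ C) (hτ : 0 ≤ τ) (hH : 0 ≤ H) (ha : ∑ k ∈ t, a k ^ 2 ≤ τ ^ 2)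
    (hb : ∑ k ∈ t, b k ^ 2 ≤ (2 * H / c) ^ 2) (hCτ : C * τ ^ 2 ≤ ε) (hτc : 4 * τ ≤ c * ε)
    (h1 : C * H ≤ 1 / 4) (h2 : C ^ 2 * τ ^ 2 * H ≤ ε) (h3 : 4 * H ≤ c ^ 2 * ε) :
    ∑ k ∈ t, ((1 + C * H) * (a k + b k)) ^ 2 ≤ ∑ k ∈ t, a k ^ 2 + 7 * ε * H := by
  have hsum := sum_add_sq_le t hτ (by positivity : 0 ≤ 2 * H / c) ha hb
  have hεH : 0 ≤ ε * H := mul_nonneg hε hH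
  have hτH : 2 * (τ * (2 * H / c)) ≤ ε * H := by
    have : 2 * (τ * (2 * H / c)) = 4 * τ * H / c := by ring
    rw [this, div_le_iff₀ hc]
    have := mul_le_mul_of_nonneg_right hτc hH
    linarith
  have hHH : (2 * H / c) ^ 2 ≤ ε * H := by
    rw [div_pow, div_le_iff₀ (by positivity)]
    have := mul_le_mul_of_nonneg_right h3 hH
    linarith
  have hCH := mul_nonneg hC hH
  have hP : (1 + C * H) ^ 2 ≤ 2 := by nlinarith
  simp only [mul_pow]
  rw [← Finset.mul_sum]
  set A := ∑ k ∈ t, a k ^ 2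
  have h4 : (1 + C * H) ^ 2 * ∑ k ∈ t, (a k + b k) ^ 2 ≤
      (1 + C * H) ^ 2 * (A + 2 * (ε * H)) :=
    mul_le_mul_of_nonneg_left (by linarith) (sq_nonneg _)
  have h5 : (2 * (C * H) + C ^ 2 * H ^ 2) * A ≤ (2 * (C * H) + C ^ 2 * H ^ 2) * τ ^ 2 :=
    mul_le_mul_of_nonneg_left ha (by positivity)
  have h6 : C * τ ^ 2 * H ≤ ε * H := mul_le_mul_of_nonneg_right hCτ hH
  have h7 : C ^ 2 * τ ^ 2 * H * H ≤ ε * H := mul_le_mul_of_nonneg_right h2 hH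
  have h8 : (1 + C * H) ^ 2 * (2 * (ε * H)) ≤ 2 * (2 * (ε * H)) :=
    mul_le_mul_of_nonneg_right hP (by positivity)
  linarith

theorem exists_finset_tail_sq_le {α : ℕ → ℝ} (hα : ∀ k, 0 ≤ α k)
    (hs : ∀ s : Finset ℕ, ∑ k ∈ s, α k ^ 2 ≤ 1) {η : ℝ} (hη : 0 < η) :
    ∃ K : Finset ℕ, (∀ k ∈ K, 0 < α k) ∧
      ∀ t : Finset ℕ, Disjoint t K → ∑ k ∈ t, α k ^ 2 ≤ η := by
  classical
  have hsum : Summable fun k => α k ^ 2 := summable_of_sum_le (fun k => sq_nonneg _) hs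
  obtain ⟨K, hK⟩ := summable_iff_vanishing_norm.1 hsum η hη
  refine ⟨K.filter fun k => 0 < α k, fun k hk => (Finset.mem_filter.1 hk).2, fun t ht => ?_⟩
  have h1 : ∑ k ∈ t, α k ^ 2 = ∑ k ∈ t \ K, α k ^ 2 := by
    refine (Finset.sum_subset Finset.sdiff_subset fun k hk hk' => ?_).symm
    have hkK : k ∈ K := by
      by_contra h
      exact hk' (Finset.mem_sdiff.2 ⟨hk, h⟩)
    have h0 : α k = 0 := by
      by_contra h
      exact Finset.disjoint_left.1 ht hk
        (Finset.mem_filter.2 ⟨hkK, lt_of_le_of_ne (hα k) (Ne.symm h)⟩)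
    rw [h0]; norm_num
  rw [h1]
  exact ((le_abs_self _).trans (hK _ Finset.sdiff_disjoint).le)

/-! ### First order upper bounds for the dual norm at elements of Λ -/

namespace SumNorms

noncomputable section

variable {X : Type*} [NormedAddCommGroup X] [NormedSpace ℝ X]
  {Y : ℕ → Type*} [∀ k, NormedAddCommGroup (Y k)] [∀ k, NormedSpace ℝ (Y k)] (S : SumNorms X Y)

/-- Absorbs a perturbation v without raising the pair norm. With b = ‖v‖ / c the pair (f, b⁻¹ v) is
admissible, and G is the convex combination of g and b⁻¹ v with weights proportional to a and b. -/
theorem exists_functional_convex {c : ℝ} (hc : 0 < c) {k : ℕ}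
    (hlower : ∀ (x : X) (y : Y k), ‖x‖ + c * ‖y‖ ≤ S.nrm k (x, y))
    {f : StrongDual ℝ X} {g : StrongDual ℝ (Y k)} (hg : ‖Pair.functional S k f g‖ ≤ 1)
    {a : ℝ} (ha : 0 ≤ a) (v : StrongDual ℝ (Y k)) :
    ∃ G : StrongDual ℝ (Y k), ‖Pair.functional S k f G‖ ≤ 1 ∧
      (a + ‖v‖ / c) • G = a • g + v := by
  by_cases hv : v = 0
  · exact ⟨g, hg, by simp [hv]⟩
  have hf : ‖f‖ ≤ 1 := (norm_le_norm_functional S k f g).trans hg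
  have hb : 0 < ‖v‖ / c := div_pos (norm_pos_iff.2 hv) hc
  set b := ‖v‖ / c with hbdef
  have hab : 0 < a + b := by linarith
  have hv' : ‖Pair.functional S k f (b⁻¹ • v)‖ ≤ 1 := by
    refine S.norm_functional_le_one hlower hf ?_
    rw [norm_smul, norm_inv, Real.norm_of_nonneg hb.le, hbdef]
    have := norm_pos_iff.2 hv
    field_simp
    exact le_rfl
  refine ⟨(a + b)⁻¹ • (a • g + v), ?_, smul_inv_smul₀ hab.ne' _⟩
  have hF : (a + b) • Pair.functional S k f ((a + b)⁻¹ • (a • g + v)) =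
      a • Pair.functional S k f g + b • Pair.functional S k f (b⁻¹ • v) := by
    rw [← Pair.functional_smul, ← Pair.functional_smul, ← Pair.functional_smul,
      ← Pair.functional_add, smul_inv_smul₀ hab.ne', smul_inv_smul₀ hb.ne', add_smul]
  have h1 : (a + b) * ‖Pair.functional S k f ((a + b)⁻¹ • (a • g + v))‖ ≤ (a + b) * 1 := by
    rw [← Real.norm_of_nonneg hab.le, ← norm_smul, Real.norm_of_nonneg hab.le, hF]
    refine (norm_add_le _ _).trans ?_
    rw [norm_smul, norm_smul, Real.norm_of_nonneg ha, Real.norm_of_nonneg hb.le]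
    nlinarith
  exact le_of_mul_le_mul_left h1 hab

set_option maxHeartbeats 400000 in
/-- A first order estimate for the dual norm near an element of `S.Lam`: finitely many coefficients
`α k`, `k ∈ K`, are perturbed linearly, the others are enlarged. -/
theorem IsLam.eventually_norm_add_le {S : SumNorms X Y} {φ : StrongDual ℝ S.Sigma}
    {f : StrongDual ℝ X} {g : ∀ k, StrongDual ℝ (Y k)} {α : ℕ → ℝ} (hφ : S.IsLam φ f g α)
    {c : ℝ} (hc : 0 < c) (hlower : ∀ k (x : X) (y : Y k), ‖x‖ + c * ‖y‖ ≤ S.nrm k (x, y))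
    {ε C τ : ℝ} (hε : 0 < ε) (hC : 0 ≤ C) (hτ : 0 ≤ τ)
    (s : StrongDual ℝ (StrongDual ℝ S.Sigma)) (K : Finset ℕ)
    (e : ℕ → StrongDual ℝ (StrongDual ℝ S.Sigma))
    (htail : ∀ t : Finset ℕ, Disjoint t K → ∑ k ∈ t, α k ^ 2 ≤ τ ^ 2)
    (hCτ : C * τ ^ 2 ≤ ε) (hτc : 4 * τ ≤ c * ε) (hK : ∀ k ∈ K, 0 < α k)
    (hD : ∀ k ∈ K, HasFDerivAt (fun h : StrongDual ℝ S.Sigma =>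
      ‖Pair.functional S k (f + S.left h) ((α k + e k h)⁻¹ • (α k • g k + S.coord k h))‖) s 0)
    (hsum : ∀ h, ∑ k ∈ K, α k * e k h = 0)
    (hfar : ∀ᶠ h in 𝓝 (0 : StrongDual ℝ S.Sigma),
      ‖(C * ‖h‖) • f + (1 + C * ‖h‖) • S.left h‖ ≤
        C * ‖h‖ + (1 + C * ‖h‖) * (s h + ε * ‖h‖)) :
    ∀ᶠ h in 𝓝 (0 : StrongDual ℝ S.Sigma), ‖φ + h‖ ≤ 1 + s h + 17 * ε * ‖h‖ := by
  classical
  have small : ∀ a b : ℝ, 0 < b → ∀ᶠ h in 𝓝 (0 : StrongDual ℝ S.Sigma), a * ‖h‖ < b := by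
    intro a b hb
    have : Tendsto (fun h : StrongDual ℝ S.Sigma => a * ‖h‖) (𝓝 0) (𝓝 0) := by
      have hcont : Continuous fun h : StrongDual ℝ S.Sigma => a * ‖h‖ := by fun_prop
      simpa using hcont.tendsto 0
    exact this.eventually_lt_const hb
  have e1 : ∀ᶠ h in 𝓝 (0 : StrongDual ℝ S.Sigma), ∀ k ∈ K,
      ‖Pair.functional S k (f + S.left h) ((α k + e k h)⁻¹ • (α k • g k + S.coord k h))‖ ≤
        1 + s h + ε * ‖h‖ := by
    refine (Filter.eventually_all_finset K).2 fun k hk => ?_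
    have h1 := (hasFDerivAt_iff_isLittleO_nhds_zero.1 (hD k hk)).def hε
    filter_upwards [h1] with h hh
    have h2 := (le_abs_self _).trans hh
    have h3 : ‖Pair.functional S k (f + S.left 0)
        ((α k + e k 0)⁻¹ • (α k • g k + S.coord k 0))‖ ≤ 1 := by
      rw [map_zero, map_zero, map_zero, add_zero, add_zero, add_zero,
        inv_smul_smul₀ (hK k hk).ne']
      exact hφ.norm_le k
    rw [zero_add] at h2
    linarith
  have e2 : ∀ᶠ h in 𝓝 (0 : StrongDual ℝ S.Sigma), ∀ k ∈ K, 0 < α k + e k h := by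
    refine (Filter.eventually_all_finset K).2 fun k hk => ?_
    have hcont : Continuous fun h : StrongDual ℝ S.Sigma => α k + e k h := by fun_prop
    have : Tendsto (fun h : StrongDual ℝ S.Sigma => α k + e k h) (𝓝 0) (𝓝 (α k)) := by
      simpa using hcont.tendsto 0
    exact this.eventually_const_lt (hK k hk)
  filter_upwards [e1, e2, hfar, small (∑ k ∈ K, ‖e k‖ ^ 2) ε hε, small C (1 / 4) (by norm_num),
    small (C ^ 2 * τ ^ 2) ε hε, small 4 (c ^ 2 * ε) (by positivity),
    small (‖s‖ + ε) (1 / 2) (by norm_num)] with h h1 h2 h3 h4 h5 h6 h7 h8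
  set H := ‖h‖ with hH
  have hH0 : 0 ≤ H := norm_nonneg h
  set P := 1 + C * H with hP
  have hP1 : 1 ≤ P := by have := mul_nonneg hC hH0; linarith
  have hP0 : 0 < P := by linarith
  have hsh : |s h| ≤ ‖s‖ * H := s.le_opNorm h
  have hR : 0 < 1 + s h + ε * H := by
    have := neg_abs_le (s h)
    nlinarith [mul_nonneg hε.le hH0]
  choose G hG hGeq using fun k => S.exists_functional_convex hc (hlower k) (hφ.norm_le k)
    (hφ.nonneg k) (S.coord k h)
  -- The square sum is 1 + 8εH: εH from K and 7εH from the rest. Every pair norm is at most 1 + s h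
  -- + εH.
  have hmain : ‖φ + h‖ ≤ (1 + 8 * ε * H) * (1 + s h + ε * H) := by
    refine S.norm_le_of_decomposition
      (g := fun k => if k ∈ K then (α k + e k h)⁻¹ • (α k • g k + S.coord k h) else P⁻¹ • G k)
      (β := fun k => if k ∈ K then α k + e k h else P * (α k + ‖S.coord k h‖ / c))
      (by nlinarith [mul_nonneg hε.le hH0]) hR (fun k => ?_) (fun t => ?_) (fun k => ?_)
      (fun k => ?_)
    · split_ifs with hk
      · exact (h2 k hk).le
      · have := hφ.nonneg k
        positivity
    · have hsplit : ∑ k ∈ t, (if k ∈ K then α k + e k h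
          else P * (α k + ‖S.coord k h‖ / c)) ^ 2 ≤
          ∑ k ∈ K, (α k + e k h) ^ 2 + ∑ k ∈ t \ K, (P * (α k + ‖S.coord k h‖ / c)) ^ 2 := by
        have ha : ∀ k ∈ K, (α k + e k h) ^ 2 = (if k ∈ K then α k + e k h
          else P * (α k + ‖S.coord k h‖ / c)) ^ 2 := fun k hk => by rw [if_pos hk]
        have hb : ∀ k ∈ t \ K, (P * (α k + ‖S.coord k h‖ / c)) ^ 2 = (if k ∈ K then α k + e k h
          else P * (α k + ‖S.coord k h‖ / c)) ^ 2 := fun k hk => by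
          rw [if_neg (Finset.mem_sdiff.1 hk).2]
        rw [Finset.sum_congr rfl ha, Finset.sum_congr rfl hb,
          ← Finset.sum_union Finset.disjoint_sdiff]
        refine Finset.sum_le_sum_of_subset_of_nonneg ?_ fun k _ _ => sq_nonneg _
        intro k hk
        by_cases hkK : k ∈ K <;> simp [hk, hkK]
      have hα1 : ∑ k ∈ K, α k ^ 2 + ∑ k ∈ t \ K, α k ^ 2 ≤ 1 := by
        rw [← Finset.sum_union Finset.disjoint_sdiff]
        exact hφ.sum_sq_le _
      have hα2 := htail (t \ K) Finset.sdiff_disjoint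
      have hα0 : 0 ≤ ∑ k ∈ t \ K, α k ^ 2 := Finset.sum_nonneg fun k _ => sq_nonneg _
      have hKsum := sum_add_sq_le_of_sum_mul_eq_zero K (hsum h) (A := ∑ k ∈ K, ‖e k‖ ^ 2) hH0
        (by
          rw [Finset.sum_mul]
          refine Finset.sum_le_sum fun k _ => ?_
          rw [← mul_pow, ← sq_abs]
          exact pow_le_pow_left₀ (abs_nonneg _) ((e k).le_opNorm h) 2) h4.le
      have hbsq : ∑ k ∈ t \ K, (‖S.coord k h‖ / c) ^ 2 ≤ (2 * H / c) ^ 2 := by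
        simp only [div_pow]
        rw [← Finset.sum_div]
        exact div_le_div_of_nonneg_right (S.sum_norm_coord_sq_le h _) (sq_nonneg c)
      have htail2 := sum_mul_add_sq_le (t \ K) hc hε.le hC hτ hH0 hα2 hbsq hCτ hτc h5.le h6.le h7.le
      linarith
    · rw [map_add, hφ.coord_eq]
      split_ifs with hk
      · rw [smul_inv_smul₀ (h2 k hk).ne']
      · rw [mul_comm, mul_smul, smul_inv_smul₀ hP0.ne', hGeq]
    · rw [map_add, hφ.left_eq]
      split_ifs with hk
      · exact h1 k hk
      -- P times the pair functional is the admissible (f, G k) plus a functional on X alone, whose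
      -- norm is controlled by `hfar`.
      · have hF : P • Pair.functional S k (f + S.left h) (P⁻¹ • G k) =
            Pair.functional S k f (G k) +
              Pair.functional S k ((C * H) • f + P • S.left h) 0 := by
          rw [← Pair.functional_smul, ← Pair.functional_add, smul_inv_smul₀ hP0.ne', add_zero]
          congr 1
          rw [hP]
          module
        have h16 : P * ‖Pair.functional S k (f + S.left h) (P⁻¹ • G k)‖ ≤
            P * (1 + s h + ε * H) := by
          rw [← Real.norm_of_nonneg hP0.le, ← norm_smul, Real.norm_of_nonneg hP0.le, hF]
          refine (norm_add_le _ _).trans ?_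
          rw [norm_functional_zero_right]
          have := hG k
          nlinarith
        exact le_of_mul_le_mul_left h16 hP0
  refine hmain.trans ?_
  have h17 : s h + ε * H ≤ 1 := by
    have := le_abs_self (s h)
    nlinarith
  nlinarith [mul_nonneg hε.le hH0]

/-- Chain rule at h = 0, where the pair functional reduces to (f, g). -/
theorem hasFDerivAt_norm_functional {k : ℕ} {f : StrongDual ℝ X} {g : StrongDual ℝ (Y k)}
    {D : StrongDual ℝ (StrongDual ℝ (S.Pair k))}
    (hD : HasFDerivAt (fun v : StrongDual ℝ (S.Pair k) => ‖v‖) D (Pair.functional S k f g))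
    {a : ℝ} (ha : a ≠ 0) (e s : StrongDual ℝ (StrongDual ℝ S.Sigma))
    (hs : ∀ h, s h = D (Pair.functional S k (S.left h)
      (a⁻¹ • S.coord k h - (a⁻¹ * e h) • g))) :
    HasFDerivAt (fun h : StrongDual ℝ S.Sigma =>
      ‖Pair.functional S k (f + S.left h) ((a + e h)⁻¹ • (a • g + S.coord k h))‖) s 0 := by
  let P₀ : StrongDual ℝ X →L[ℝ] StrongDual ℝ (S.Pair k) :=
    ContinuousLinearMap.precomp ℝ (Pair.fst S k)
  let P₁ : StrongDual ℝ (Y k) →L[ℝ] StrongDual ℝ (S.Pair k) :=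
    ContinuousLinearMap.precomp ℝ (Pair.snd S k)
  have hfun : ∀ f' g', Pair.functional S k f' g' = P₀ f' + P₁ g' := fun _ _ => rfl
  have h1 : HasFDerivAt (fun h : StrongDual ℝ S.Sigma => f + S.left h) S.left 0 :=
    S.left.hasFDerivAt.const_add f
  have h2 : HasFDerivAt (fun h : StrongDual ℝ S.Sigma => a • g + S.coord k h) (S.coord k) 0 :=
    (S.coord k).hasFDerivAt.const_add _
  have h3 : HasFDerivAt (fun h : StrongDual ℝ S.Sigma => a + e h) e 0 :=
    e.hasFDerivAt.const_add _
  have h4 : HasFDerivAt (fun h : StrongDual ℝ S.Sigma => (a + e h)⁻¹)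
      ((-((a + e 0) ^ 2)⁻¹) • e) 0 :=
    (hasDerivAt_inv (by simpa using ha)).comp_hasFDerivAt 0 h3
  have h5 := (P₀.hasFDerivAt.comp 0 h1).add (P₁.hasFDerivAt.comp 0 (h4.smul h2))
  have h6 : Pair.functional S k f g =
      Pair.functional S k (f + S.left 0) ((a + e 0)⁻¹ • (a • g + S.coord k 0)) := by
    rw [map_zero, map_zero, map_zero, add_zero, add_zero, add_zero, inv_smul_smul₀ ha]
  rw [h6] at hD
  have h7 := HasFDerivAt.comp (0 : StrongDual ℝ S.Sigma) (f := fun h =>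
    Pair.functional S k (f + S.left h) ((a + e h)⁻¹ • (a • g + S.coord k h))) hD h5
  refine h7.congr_fderiv ?_
  ext h
  rw [hs, hfun, ContinuousLinearMap.comp_apply]
  congr 1
  simp only [map_zero, add_zero, add_apply, ContinuousLinearMap.comp_apply, smul_apply,
    ContinuousLinearMap.smulRight_apply]
  congr 2
  ext y
  simp only [add_apply, sub_apply, smul_apply, smul_eq_mul]
  field_simp
  ring

theorem norm_le_norm_functional_right (k : ℕ) (f : StrongDual ℝ X) (g : StrongDual ℝ (Y k)) :
    ‖g‖ ≤ ‖Pair.functional S k f g‖ := by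
  refine ContinuousLinearMap.opNorm_le_bound _ (norm_nonneg _) fun y => ?_
  have h := (Pair.functional S k f g).le_opNorm (show S.Pair k from (0, y))
  rw [Pair.functional_apply, Pair.norm_def] at h
  change ‖f 0 + g y‖ ≤ _ * S.nrm k (0, y) at h
  rwa [S.nrm_right, map_zero, zero_add] at h

theorem norm_functional_zero_left_le (k : ℕ) (g : StrongDual ℝ (Y k)) :
    ‖Pair.functional S k 0 g‖ ≤ 2 * ‖g‖ := by
  refine ContinuousLinearMap.opNorm_le_bound _ (by positivity) fun z => ?_
  rw [Pair.functional_apply, zero_apply, zero_add]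
  have h1 := g.le_opNorm z.2
  have h2 := mul_le_mul_of_nonneg_left (S.norm_snd_le k z.1 z.2) (norm_nonneg g)
  have h3 : S.nrm k (z.1, z.2) = ‖z‖ := rfl
  rw [h3] at h2
  linarith

/-- Monotonicity makes f ↦ (f, 0) an isometric embedding of X* into the dual of X ⊕ Y 0. -/
theorem frechetSmooth_dual_left (hsmooth : FrechetSmooth (StrongDual ℝ (S.Pair 0))) :
    FrechetSmooth (StrongDual ℝ X) := by
  intro f hf
  let P : StrongDual ℝ X →L[ℝ] StrongDual ℝ (S.Pair 0) :=
    ContinuousLinearMap.precomp ℝ (Pair.fst S 0)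
  have hP : ∀ v, ‖P v‖ = ‖v‖ := fun v => by
    rw [← norm_functional_zero_right S 0 v]
    congr 1
    ext z
    rw [Pair.functional_apply, zero_apply, add_zero]
    rfl
  have h0 : P f ≠ 0 := fun h => hf (norm_eq_zero.1 (by rw [← hP, h, norm_zero]))
  have h := DifferentiableAt.comp (f := P) f (hsmooth (P f) h0) P.differentiableAt
  exact h.congr_of_eventuallyEq (Eventually.of_forall fun v => (hP v).symm)

theorem exists_tolerance {c C ε : ℝ} (hc : 0 < c) (hC : 0 ≤ C) (hε : 0 < ε) :
    ∃ τ > 0, C * τ ^ 2 ≤ ε ∧ 4 * τ ≤ c * ε := by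
  refine ⟨min (c * ε / 4) (min 1 (ε / (C + 1))), by positivity, ?_, ?_⟩
  · set τ := min (c * ε / 4) (min 1 (ε / (C + 1)))
    have h1 : τ ≤ 1 := (min_le_right _ _).trans (min_le_left _ _)
    have h2 : τ ≤ ε / (C + 1) := (min_le_right _ _).trans (min_le_right _ _)
    have h0 : 0 < τ := by positivity
    rw [le_div_iff₀ (by positivity)] at h2
    nlinarith [mul_nonneg hC h0.le]
  · linarith [min_le_left (c * ε / 4) (min 1 (ε / (C + 1)))]

theorem eventually_mul_norm_le {E : Type*} [NormedAddCommGroup E] (a : ℝ) {b : ℝ} (hb : 0 < b) :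
    ∀ᶠ h in 𝓝 (0 : E), a * ‖h‖ ≤ b := by
  have hcont : Continuous fun h : E => a * ‖h‖ := by fun_prop
  have : Tendsto (fun h : E => a * ‖h‖) (𝓝 0) (𝓝 0) := by simpa using hcont.tendsto 0
  exact (this.eventually_lt_const hb).mono fun _ h => h.le

variable {S}

/-- Here every pair (f, g k) has norm 1 and is normed by (a, 0). The pair derivative is therefore
evaluation at (a, 0), which ignores the Y-part; all of them equal s with e = 0. -/
theorem IsLam.eventually_norm_add_le_of_norm_eq_one {φ : StrongDual ℝ S.Sigma}
    {f : StrongDual ℝ X} {g : ∀ k, StrongDual ℝ (Y k)} {α : ℕ → ℝ} (hφ : S.IsLam φ f g α)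
    (hsmooth : ∀ k, FrechetSmooth (StrongDual ℝ (S.Pair k)))
    {c : ℝ} (hc : 0 < c) (hlower : ∀ k (x : X) (y : Y k), ‖x‖ + c * ‖y‖ ≤ S.nrm k (x, y))
    (hf : ‖f‖ = 1) {a : X} (ha : ‖a‖ ≤ 1) (hfa : f a = 1) {ε : ℝ} (hε : 0 < ε) :
    ∃ s : StrongDual ℝ (StrongDual ℝ S.Sigma),
      ∀ᶠ h in 𝓝 (0 : StrongDual ℝ S.Sigma), ‖φ + h‖ ≤ 1 + s h + 17 * ε * ‖h‖ := by
  have hf0 : f ≠ 0 := fun h => by rw [h, norm_zero] at hf; norm_num at hf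
  have hder := (S.frechetSmooth_dual_left (hsmooth 0) f hf0).hasFDerivAt
  have heval := fderiv_norm_eq_of_norming hder ha (by rw [hfa, hf])
  obtain ⟨r, hr, hball⟩ := Metric.eventually_nhds_iff_ball.1
    ((hasFDerivAt_iff_isLittleO_nhds_zero.1 hder).def hε)
  have hnear : ∀ v : StrongDual ℝ X, ‖v‖ < r → ‖f + v‖ ≤ 1 + v a + ε * ‖v‖ := by
    intro v hv
    have := (le_abs_self _).trans (hball v (by simpa using hv))
    rw [heval, hf] at this
    linarith
  -- Since P ≤ 2 for small h, the vector `(P / (C * ‖h‖)) • S.left h` has norm at most 2 / C = r /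
  -- 2, inside the ball where `hnear` applies.
  set C := 4 / r with hCdef
  have hC : 0 < C := by positivity
  obtain ⟨τ, hτ, hCτ, hτc⟩ := exists_tolerance hc hC.le hε
  obtain ⟨K, hK, htail⟩ := exists_finset_tail_sq_le hφ.nonneg hφ.sum_sq_le
    (show 0 < τ ^ 2 by positivity)
  let s : StrongDual ℝ (StrongDual ℝ S.Sigma) :=
    (NormedSpace.inclusionInDoubleDual ℝ X a).comp S.left
  have hs : ∀ h, s h = S.left h a := fun h => rfl
  refine ⟨s, hφ.eventually_norm_add_le hc hlower hε hC.le hτ.le s K 0 htail hCτ hτc hK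
    (fun k hk => ?_) (fun h => by simp) ?_⟩
  · have hF : ‖Pair.functional S k f (g k)‖ = 1 :=
      le_antisymm (hφ.norm_le k) (hf ▸ norm_le_norm_functional S k f (g k))
    have hF0 : Pair.functional S k f (g k) ≠ 0 := fun h => by
      rw [h, norm_zero] at hF; norm_num at hF
    have hD := (hsmooth k _ hF0).hasFDerivAt
    refine hasFDerivAt_norm_functional S hD (hK k hk).ne' _ _ fun h => ?_
    rw [fderiv_norm_eq_of_norming hD (x := (show S.Pair k from (a, 0)))]
    · rw [hs, Pair.functional_apply]
      change _ = S.left h a + _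
      exact (by rw [map_zero, add_zero])
    · rw [Pair.norm_def]
      exact (S.nrm_left k a).trans_le ha
    · rw [hF, Pair.functional_apply]
      change f a + g k 0 = 1
      rw [map_zero, add_zero, hfa]
  · filter_upwards [eventually_mul_norm_le C one_pos] with h h1
    by_cases h0 : h = 0
    · subst h0; simp
    have hH : 0 < ‖h‖ := norm_pos_iff.2 h0
    have hCH : 0 < C * ‖h‖ := by positivity
    have hl := S.norm_left_le h
    set P := 1 + C * ‖h‖ with hP
    have hP0 : 0 < P := by positivity
    have hv : ‖(P / (C * ‖h‖)) • S.left h‖ < r := by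
      rw [norm_smul, Real.norm_of_nonneg (by positivity)]
      have h2 : P / (C * ‖h‖) * ‖S.left h‖ ≤ 2 / (C * ‖h‖) * ‖h‖ := by
        refine mul_le_mul ?_ hl (norm_nonneg _) (by positivity)
        exact div_le_div_of_nonneg_right (by linarith) hCH.le
      have h3 : 2 / (C * ‖h‖) * ‖h‖ = r / 2 := by
        rw [hCdef]; field_simp; norm_num
      linarith
    have h2 := hnear _ hv
    have h3 : (C * ‖h‖) • f + P • S.left h =
        (C * ‖h‖) • (f + (P / (C * ‖h‖)) • S.left h) := by
      rw [smul_add, smul_smul, mul_div_cancel₀ _ hCH.ne']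
    rw [h3, norm_smul, Real.norm_of_nonneg hCH.le]
    rw [smul_apply, smul_eq_mul, norm_smul, Real.norm_of_nonneg (by positivity)] at h2
    calc C * ‖h‖ * ‖f + (P / (C * ‖h‖)) • S.left h‖
        ≤ C * ‖h‖ * (1 + P / (C * ‖h‖) * S.left h a + ε * (P / (C * ‖h‖) * ‖S.left h‖)) :=
          mul_le_mul_of_nonneg_left h2 hCH.le
      _ = C * ‖h‖ + P * (s h + ε * ‖S.left h‖) := by rw [hs]; field_simp; ring
      _ ≤ C * ‖h‖ + P * (s h + ε * ‖h‖) := by gcongr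

/-- The k-th pair norm has derivative (α k)⁻¹ (B k - q k e k). Equating it with s gives e k = (B k -
α k s) / q k, and ∑ α k e k = 0 then determines s. Division is possible because D k is 1 at (f, g k)
but at most ‖f‖ at (f, 0), so q k ≥ 1 - ‖f‖ = γ. -/
theorem IsLam.eventually_norm_add_le_of_norm_lt_one {φ : StrongDual ℝ S.Sigma}
    {f : StrongDual ℝ X} {g : ∀ k, StrongDual ℝ (Y k)} {α : ℕ → ℝ} (hφ : S.IsLam φ f g α)
    (hsmooth : ∀ k, FrechetSmooth (StrongDual ℝ (S.Pair k)))
    {c : ℝ} (hc : 0 < c) (hlower : ∀ k (x : X) (y : Y k), ‖x‖ + c * ‖y‖ ≤ S.nrm k (x, y))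
    (hf : ‖f‖ < 1) (hF : ∀ k, 0 < α k → ‖Pair.functional S k f (g k)‖ = 1)
    {j : ℕ} (hj : 0 < α j) {ε : ℝ} (hε : 0 < ε) :
    ∃ s : StrongDual ℝ (StrongDual ℝ S.Sigma),
      ∀ᶠ h in 𝓝 (0 : StrongDual ℝ S.Sigma), ‖φ + h‖ ≤ 1 + s h + 17 * ε * ‖h‖ := by
  classical
  set γ := 1 - ‖f‖ with hγdef
  have hγ : 0 < γ := by linarith
  -- A bound for ‖s‖ that does not depend on K: C is built from L, τ from C, and only then K from τ.
  set L := 10 / (γ * α j ^ 2) with hL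
  have hL0 : 0 < L := by positivity
  -- Chosen so that the gain CγH from ‖f‖ = 1 - γ covers (1 + CH)(H - s h) ≤ 2(1 + L)H.
  set C := 2 * (1 + L) / γ with hCdef
  have hC : 0 < C := by positivity
  obtain ⟨τ, hτ, hCτ, hτc⟩ := exists_tolerance hc hC.le hε
  obtain ⟨K₀, hK₀, htail₀⟩ := exists_finset_tail_sq_le hφ.nonneg hφ.sum_sq_le
    (show 0 < τ ^ 2 by positivity)
  -- Including j keeps Q ≥ α j² / 2, whatever K₀ is.
  set K := insert j K₀ with hKdef
  have hK : ∀ k ∈ K, 0 < α k := fun k hk => by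
    rcases Finset.mem_insert.1 hk with rfl | h
    exacts [hj, hK₀ k h]
  have htail : ∀ t : Finset ℕ, Disjoint t K → ∑ k ∈ t, α k ^ 2 ≤ τ ^ 2 := fun t ht =>
    htail₀ t (ht.mono_right (Finset.subset_insert j K₀))
  let D : ∀ k, StrongDual ℝ (StrongDual ℝ (S.Pair k)) := fun k =>
    fderiv ℝ (fun v : StrongDual ℝ (S.Pair k) => ‖v‖) (Pair.functional S k f (g k))
  have hdiff : ∀ k, 0 < α k → DifferentiableAt ℝ (fun v : StrongDual ℝ (S.Pair k) => ‖v‖)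
      (Pair.functional S k f (g k)) := fun k hk => by
    refine hsmooth k _ fun h => ?_
    have := hF k hk
    rw [h, norm_zero] at this
    norm_num at this
  have hD1 : ∀ k, ‖D k‖ ≤ 1 := fun k => by
    simpa using norm_fderiv_le_of_lipschitz ℝ (x₀ := Pair.functional S k f (g k))
      (lipschitzWith_one_norm (E := StrongDual ℝ (S.Pair k)))
  have hDle : ∀ k v, |D k v| ≤ ‖v‖ := fun k v => by
    simpa using (D k).le_of_opNorm_le (hD1 k) v
  let q : ℕ → ℝ := fun k => D k (Pair.functional S k 0 (g k))
  have hqγ : ∀ k, 0 < α k → γ ≤ q k := fun k hk => by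
    have h1 : D k (Pair.functional S k f (g k)) = 1 := by
      have := (hdiff k hk).fderiv_norm_self
      rw [hF k hk] at this
      exact this
    have h2 : Pair.functional S k f (g k) =
        Pair.functional S k f 0 + Pair.functional S k 0 (g k) := by
      rw [← Pair.functional_add, add_zero, zero_add]
    rw [h2, map_add] at h1
    have h3 := (le_abs_self _).trans (hDle k (Pair.functional S k f 0))
    rw [norm_functional_zero_right] at h3
    change γ ≤ D k (Pair.functional S k 0 (g k))
    linarith
  have hq2 : ∀ k, q k ≤ 2 := fun k => by
    have h1 := (le_abs_self _).trans (hDle k (Pair.functional S k 0 (g k)))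
    have h2 := S.norm_functional_zero_left_le k (g k)
    have h3 := (S.norm_le_norm_functional_right k f (g k)).trans (hφ.norm_le k)
    change D k (Pair.functional S k 0 (g k)) ≤ 2
    linarith
  have hq0 : ∀ k ∈ K, 0 < q k := fun k hk => hγ.trans_le (hqγ k (hK k hk))
  let B : ℕ → StrongDual ℝ (StrongDual ℝ S.Sigma) := fun k =>
    (D k).comp (α k • (ContinuousLinearMap.precomp ℝ (Pair.fst S k)).comp S.left +
      (ContinuousLinearMap.precomp ℝ (Pair.snd S k)).comp (S.coord k))
  have hB : ∀ k h, B k h = D k (Pair.functional S k (α k • S.left h) (S.coord k h)) := by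
    intro k h
    refine congrArg (D k) ?_
    ext z
    rfl
  set Q := ∑ k ∈ K, α k ^ 2 / q k with hQ
  have hQj : α j ^ 2 / 2 ≤ Q := by
    have h1 : α j ^ 2 / q j ≤ Q := Finset.single_le_sum (f := fun k => α k ^ 2 / q k)
      (fun k hk => div_nonneg (sq_nonneg _) (hq0 k hk).le) (Finset.mem_insert_self j K₀)
    exact (div_le_div_of_nonneg_left (sq_nonneg _)
      (hq0 j (Finset.mem_insert_self j K₀)) (hq2 j)).trans h1
  have hQ0 : 0 < Q := lt_of_lt_of_le (by positivity) hQj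
  let s : StrongDual ℝ (StrongDual ℝ S.Sigma) := Q⁻¹ • ∑ k ∈ K, (α k / q k) • B k
  have hs : ∀ h, Q * s h = ∑ k ∈ K, α k / q k * B k h := fun h => by
    simp only [s, smul_apply, sum_apply, smul_eq_mul]
    rw [mul_inv_cancel_left₀ hQ0.ne']
  have hsL : ∀ h, |s h| ≤ L * ‖h‖ := by
    intro h
    have h1 : ∀ k ∈ K, |α k / q k * B k h| ≤
        γ⁻¹ * (α k ^ 2 * ‖h‖ + 2 * (α k * ‖S.coord k h‖)) := by
      intro k hk
      rw [abs_mul, abs_of_nonneg (div_nonneg (hK k hk).le (hq0 k hk).le)]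
      have h2 : |B k h| ≤ α k * ‖h‖ + 2 * ‖S.coord k h‖ := by
        rw [hB]
        refine (hDle k _).trans ?_
        have h3 : Pair.functional S k (α k • S.left h) (S.coord k h) =
            Pair.functional S k (α k • S.left h) 0 +
              Pair.functional S k 0 (S.coord k h) := by
          rw [← Pair.functional_add, add_zero, zero_add]
        rw [h3]
        refine (norm_add_le _ _).trans (add_le_add ?_ (S.norm_functional_zero_left_le k _))
        rw [norm_functional_zero_right, norm_smul, Real.norm_of_nonneg (hK k hk).le]
        exact mul_le_mul_of_nonneg_left (S.norm_left_le h) (hK k hk).le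
      have h4 : α k / q k ≤ γ⁻¹ * α k := by
        rw [inv_mul_eq_div]
        exact div_le_div_of_nonneg_left (hK k hk).le hγ (hqγ k (hK k hk))
      calc α k / q k * |B k h| ≤ γ⁻¹ * α k * (α k * ‖h‖ + 2 * ‖S.coord k h‖) :=
            mul_le_mul h4 h2 (abs_nonneg _) (by have := (hK k hk).le; positivity)
        _ = _ := by ring
    -- 5 = 1 + 2 · 2: ∑ α k² ≤ 1 for the X-part, and Cauchy–Schwarz with coordinate ℓ²-norm at most
    -- 2‖h‖ for the Y-part.
    have h5 : |Q * s h| ≤ γ⁻¹ * (5 * ‖h‖) := by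
      rw [hs]
      refine (Finset.abs_sum_le_sum_abs _ _).trans ((Finset.sum_le_sum h1).trans ?_)
      rw [← Finset.mul_sum, Finset.sum_add_distrib, ← Finset.sum_mul, ← Finset.mul_sum]
      refine mul_le_mul_of_nonneg_left ?_ (inv_nonneg.2 hγ.le)
      have h6 := sum_mul_le_of_sq_le K zero_le_one (by positivity : 0 ≤ 2 * ‖h‖)
        (by rw [one_pow]; exact hφ.sum_sq_le K) (S.sum_norm_coord_sq_le h K)
      have h7 := mul_le_mul_of_nonneg_right (hφ.sum_sq_le K) (norm_nonneg h)
      linarith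
    rw [abs_mul, abs_of_pos hQ0] at h5
    have h8 := mul_le_mul_of_nonneg_right hQj (abs_nonneg (s h))
    have h9 : α j ^ 2 / 2 * |s h| ≤ γ⁻¹ * (5 * ‖h‖) := h8.trans h5
    have h10 : L * ‖h‖ = (γ⁻¹ * (5 * ‖h‖)) / (α j ^ 2 / 2) := by
      rw [hL]; field_simp; ring
    rw [h10, le_div_iff₀ (by positivity)]
    linarith
  let e : ℕ → StrongDual ℝ (StrongDual ℝ S.Sigma) := fun k => (q k)⁻¹ • (B k - α k • s)
  have he : ∀ k h, e k h = (q k)⁻¹ * (B k h - α k * s h) := fun k h => rfl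
  refine ⟨s, hφ.eventually_norm_add_le hc hlower hε hC.le hτ.le s K e htail hCτ hτc hK
    (fun k hk => ?_) (fun h => ?_) ?_⟩
  · refine hasFDerivAt_norm_functional S (hdiff k (hK k hk)).hasFDerivAt (hK k hk).ne' _ _
      fun h => ?_
    change s h = D k _
    have h1 : Pair.functional S k (S.left h)
        ((α k)⁻¹ • S.coord k h - ((α k)⁻¹ * e k h) • g k) =
        (α k)⁻¹ • (Pair.functional S k (α k • S.left h) (S.coord k h) -
          e k h • Pair.functional S k 0 (g k)) := by
      ext z
      have := (hK k hk).ne'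
      simp only [Pair.functional_apply, sub_apply, smul_apply, smul_eq_mul, zero_apply]
      field_simp
      ring
    rw [h1, map_smul, map_sub, map_smul, ← hB, smul_eq_mul, smul_eq_mul, he]
    change s h = (α k)⁻¹ * (B k h - (q k)⁻¹ * (B k h - α k * s h) * q k)
    have h2 := (hK k hk).ne'
    have h3 := (hq0 k hk).ne'
    field_simp
    ring
  · have h1 : ∀ k ∈ K, α k * e k h = α k / q k * B k h - α k ^ 2 / q k * s h := fun k _ => by
      rw [he]; ring
    rw [Finset.sum_congr rfl h1, Finset.sum_sub_distrib, ← Finset.sum_mul, ← hs, sub_self]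
  · filter_upwards [eventually_mul_norm_le C one_pos] with h h1
    set H := ‖h‖ with hH
    have hH0 : 0 ≤ H := norm_nonneg h
    have hCH : 0 ≤ C * H := by positivity
    have h2 : ‖(C * H) • f + (1 + C * H) • S.left h‖ ≤ C * H * ‖f‖ + (1 + C * H) * H := by
      refine (norm_add_le _ _).trans ?_
      rw [norm_smul, norm_smul, Real.norm_of_nonneg hCH, Real.norm_of_nonneg (by positivity)]
      exact add_le_add le_rfl (mul_le_mul_of_nonneg_left (S.norm_left_le h) (by positivity))
    have h3 : ‖f‖ = 1 - γ := by rw [hγdef]; ring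
    have h4 : C * γ = 2 * (1 + L) := by rw [hCdef]; field_simp
    have h5 := (abs_le.1 (hsL h)).1
    rw [h3] at h2
    have h6 : (1 + C * H) * (H - s h) ≤ 2 * ((1 + L) * H) := by
      have h7 : H - s h ≤ (1 + L) * H := by linarith
      calc (1 + C * H) * (H - s h) ≤ (1 + C * H) * ((1 + L) * H) :=
            mul_le_mul_of_nonneg_left h7 (by positivity)
        _ ≤ 2 * ((1 + L) * H) := mul_le_mul_of_nonneg_right (by linarith) (by positivity)
    have h8 : C * H * (1 - γ) = C * H - 2 * ((1 + L) * H) := by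
      have : C * H * (1 - γ) = C * H - C * γ * H := by ring
      rw [this, h4]; ring
    have h9 : 0 ≤ (1 + C * H) * (ε * H) := by positivity
    rw [h8] at h2
    linarith

/-- Stretching g k by some t ≥ 1 until the pair norm reaches 1, and dividing α k by t, leaves φ
unchanged and only lowers the coefficients. If g k = 0 the coefficient is set to 0. -/
theorem IsLam.exists_rescale {φ : StrongDual ℝ S.Sigma}
    {f : StrongDual ℝ X} {g : ∀ k, StrongDual ℝ (Y k)} {α : ℕ → ℝ} (hφ : S.IsLam φ f g α) :
    ∃ (g' : ∀ k, StrongDual ℝ (Y k)) (α' : ℕ → ℝ), S.IsLam φ f g' α' ∧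
      ∀ k, 0 < α' k → ‖Pair.functional S k f (g' k)‖ = 1 := by
  have hex : ∀ k, ∃ (G : StrongDual ℝ (Y k)) (a : ℝ), 0 ≤ a ∧ a ≤ α k ∧ a • G = α k • g k ∧
      ‖Pair.functional S k f G‖ ≤ 1 ∧ (0 < a → ‖Pair.functional S k f G‖ = 1) := by
    intro k
    by_cases hg : g k = 0
    · refine ⟨g k, 0, le_rfl, hφ.nonneg k, by rw [hg, smul_zero, smul_zero], hφ.norm_le k,
        fun h => absurd h (lt_irrefl _)⟩
    · have hgpos : 0 < ‖g k‖ := norm_pos_iff.2 hg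
      have hg1 : ‖g k‖ ≤ 1 := (S.norm_le_norm_functional_right k f (g k)).trans (hφ.norm_le k)
      have hcont : Continuous fun t : ℝ => ‖Pair.functional S k f (t • g k)‖ := by
        have : ∀ t : ℝ, Pair.functional S k f (t • g k) =
            Pair.functional S k f 0 + t • Pair.functional S k 0 (g k) := fun t => by
          rw [← Pair.functional_smul, ← Pair.functional_add, smul_zero, add_zero, zero_add]
        simp only [this]
        fun_prop
      have hT : 1 ≤ ‖g k‖⁻¹ := (one_le_inv₀ hgpos).2 hg1
      have hTn : 1 ≤ ‖Pair.functional S k f (‖g k‖⁻¹ • g k)‖ := by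
        refine le_trans (le_of_eq ?_) (S.norm_le_norm_functional_right k f _)
        rw [norm_smul, norm_inv, norm_norm, inv_mul_cancel₀ hgpos.ne']
      obtain ⟨t, ht, htn⟩ := intermediate_value_Icc hT hcont.continuousOn
        (⟨by rw [one_smul]; exact hφ.norm_le k, hTn⟩ : (1 : ℝ) ∈ Set.Icc _ _)
      have ht0 : 0 < t := lt_of_lt_of_le one_pos ht.1
      refine ⟨t • g k, α k / t, div_nonneg (hφ.nonneg k) ht0.le,
        div_le_self (hφ.nonneg k) ht.1, ?_, htn.le, fun _ => htn⟩
      rw [smul_smul, div_mul_cancel₀ _ ht0.ne']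
  choose G a ha haα haG hG hG1 using hex
  refine ⟨G, a, ⟨hφ.left_eq, fun k => by rw [hφ.coord_eq, haG], hG, ha, fun s => ?_⟩, hG1⟩
  exact (Finset.sum_le_sum fun k _ => pow_le_pow_left₀ (ha k) (haα k) 2).trans (hφ.sum_sq_le s)

/-- Slices of the unit ball of `S.Sigma` given by norm attaining elements of `S.Lam` shrink. -/
theorem IsLam.slices_shrink {φ : StrongDual ℝ S.Sigma}
    {f : StrongDual ℝ X} {g : ∀ k, StrongDual ℝ (Y k)} {α : ℕ → ℝ} (hφ : S.IsLam φ f g α)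
    [CompleteSpace X] (hsmooth : ∀ k, FrechetSmooth (StrongDual ℝ (S.Pair k)))
    {c : ℝ} (hc : 0 < c) (hlower : ∀ k (x : X) (y : Y k), ‖x‖ + c * ‖y‖ ≤ S.nrm k (x, y))
    {z : S.Sigma} (hz : ‖z‖ ≤ 1) (hφz : φ z = 1) {ε : ℝ} (hε : 0 < ε) :
    ∃ δ > 0, ∀ v w : S.Sigma, ‖v‖ ≤ 1 → ‖w‖ ≤ 1 → 1 - δ < φ v → 1 - δ < φ w →
      ‖v - w‖ ≤ ε := by
  refine slices_shrink_of_norm_add_le (fun η hη => ?_) hε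
  have hη' : 0 < η / 17 := by positivity
  have h17 : 17 * (η / 17) = η := by ring
  have hf1 : ‖f‖ ≤ 1 := (norm_le_norm_functional S 0 f (g 0)).trans (hφ.norm_le 0)
  rcases hf1.eq_or_lt with hf | hf
  · obtain ⟨Φ, hΦ, hΦf⟩ := exists_dual_vector ℝ f (by rw [hf]; norm_num)
    obtain ⟨a, ha⟩ := (S.frechetSmooth_dual_left (hsmooth 0)).exists_eq_inclusionInDoubleDual Φ
    have ha1 : ‖a‖ ≤ 1 := by
      refine NormedSpace.norm_le_dual_bound ℝ a zero_le_one fun g => ?_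
      rw [← ha]
      exact Φ.le_of_opNorm_le hΦ.le g
    have hfa : f a = 1 := by
      rw [← ha, hΦf, hf]
      rfl
    have := hφ.eventually_norm_add_le_of_norm_eq_one hsmooth hc hlower hf ha1 hfa hη'
    rwa [h17] at this
  · obtain ⟨g', α', hφ', hF⟩ := hφ.exists_rescale
    -- Otherwise φ would be f alone, which cannot reach 1 on the unit ball as ‖f‖ < 1.
    have hj : ∃ j, 0 < α' j := by
      by_contra! h
      have h0 : ∀ k, α' k = 0 := fun k => le_antisymm (h k) (hφ'.nonneg k)
      have h1 := S.hasSum_coord φ z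
      simp only [hφ'.coord_eq, h0, zero_smul, zero_apply, hφ'.left_eq] at h1
      have h2 := h1.unique hasSum_zero
      have h3 := (le_abs_self _).trans (f.le_opNorm z.1)
      have h4 := (Sigma.norm_fst_le S z).trans hz
      nlinarith [norm_nonneg f, norm_nonneg z.1]
    obtain ⟨j, hj⟩ := hj
    have := hφ'.eventually_norm_add_le_of_norm_lt_one hsmooth hc hlower hf hF hj hη'
    rwa [h17] at this

/-! ### Weak limits in the unit ball and attainment of the norm on Λ -/

variable (S)

instance Pair.completeSpace [CompleteSpace X] (k : ℕ) [CompleteSpace (Y k)] : CompleteSpace (S.Pair k) := by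
  refine Metric.complete_of_cauchySeq_tendsto fun u hu => ?_
  obtain ⟨x, hx⟩ := cauchySeq_tendsto_of_complete
    ((Pair.fst S k).uniformContinuous.comp_cauchySeq hu)
  obtain ⟨y, hy⟩ := cauchySeq_tendsto_of_complete
    ((Pair.snd S k).uniformContinuous.comp_cauchySeq hu)
  refine ⟨(show S.Pair k from (x, y)), tendsto_iff_norm_sub_tendsto_zero.2 ?_⟩
  rw [tendsto_iff_norm_sub_tendsto_zero] at hx hy
  refine squeeze_zero (fun n => norm_nonneg _) (fun n => ?_) (by simpa using hx.add hy)
  have h1 : u n - (show S.Pair k from (x, y)) =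
      (show S.Pair k from ((u n).1 - x, 0)) + (show S.Pair k from (0, (u n).2 - y)) :=
    Prod.ext (add_zero _).symm (zero_add _).symm
  refine (congrArg norm h1).trans_le ((norm_add_le _ _).trans_eq ?_)
  rw [Pair.norm_def, Pair.norm_def]
  exact congrArg₂ (· + ·) (S.nrm_left k _) (S.nrm_right k _)

/-- Reflexivity passes from X ⊕ Y k to its complemented summand Y k. -/
theorem exists_eq_apply_right [CompleteSpace X] {k : ℕ} [CompleteSpace (Y k)]
    (hsmooth : FrechetSmooth (StrongDual ℝ (S.Pair k)))
    (Φ : StrongDual ℝ (StrongDual ℝ (Y k))) :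
    ∃ y : Y k, ∀ g : StrongDual ℝ (Y k), Φ g = g y := by
  let J : Y k →L[ℝ] S.Pair k := LinearMap.mkContinuous
    (LinearMap.inr ℝ X (Y k) : Y k →ₗ[ℝ] S.Pair k) 1
    (fun y => by rw [one_mul]; exact (S.nrm_right k y).le)
  obtain ⟨z, hz⟩ := hsmooth.exists_eq_inclusionInDoubleDual
    (Φ.comp (ContinuousLinearMap.precomp ℝ J))
  refine ⟨z.2, fun g => ?_⟩
  have h1 := hz (g.comp (Pair.snd S k))
  exact h1

/-- The limit is taken coordinatewise. Convergence against φ follows because the coordinates of φ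
are square summable while the Y-parts are uniformly bounded in ℓ² by 1 / c, so tails are uniformly
small. -/
theorem exists_weak_limit {c : ℝ} (hc : 0 < c)
    (hlower : ∀ k (x : X) (y : Y k), ‖x‖ + c * ‖y‖ ≤ S.nrm k (x, y))
    (hX : ∀ Φ : StrongDual ℝ (StrongDual ℝ X), ∃ x : X, ∀ f, Φ f = f x)
    (hY : ∀ k, ∀ Φ : StrongDual ℝ (StrongDual ℝ (Y k)), ∃ y : Y k, ∀ g, Φ g = g y)
    {ι : Type*} (U : Ultrafilter ι) (w : ι → S.Sigma) (hw : ∀ i, ‖w i‖ ≤ 1) :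
    ∃ z : S.Sigma, ∀ φ : StrongDual ℝ S.Sigma, Tendsto (fun i => φ (w i)) U (𝓝 (φ z)) := by
  obtain ⟨x, hx⟩ := _root_.exists_weak_limit hX U (fun i => (w i).1)
    (fun i => (Sigma.norm_fst_le S (w i)).trans (hw i))
  have hYlim := fun k => _root_.exists_weak_limit (hY k) U (fun i => (w i).2 k) (R := 2)
    (fun i => (Sigma.norm_snd_le S (w i) k).trans (by linarith [hw i]))
  choose y hy using hYlim
  have hwsq : ∀ i (s : Finset ℕ), ∑ k ∈ s, ‖(w i).2 k‖ ^ 2 ≤ (1 / c) ^ 2 := fun i s =>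
    (S.sum_norm_snd_sq_le hc hlower (w i) s).trans (pow_le_pow_left₀
      (div_nonneg (norm_nonneg _) hc.le) (div_le_div_of_nonneg_right (hw i) hc.le) 2)
  have hysq : ∀ s : Finset ℕ, ∑ k ∈ s, ‖y k‖ ^ 2 ≤ (1 / c) ^ 2 := by
    intro s
    choose g hg hgy using fun k => exists_dual_vector'' ℝ (y k)
    have hlim : Tendsto (fun i => ∑ k ∈ s, g k ((w i).2 k) ^ 2) U
        (𝓝 (∑ k ∈ s, g k (y k) ^ 2)) := tendsto_finsetSum s fun k _ => (hy k (g k)).pow 2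
    have h1 : ∑ k ∈ s, g k (y k) ^ 2 = ∑ k ∈ s, ‖y k‖ ^ 2 :=
      Finset.sum_congr rfl fun k _ => by rw [hgy]; rfl
    rw [← h1]
    refine le_of_tendsto hlim (Eventually.of_forall fun i => le_trans ?_ (hwsq i s))
    refine Finset.sum_le_sum fun k _ => ?_
    rw [← sq_abs]
    refine pow_le_pow_left₀ (abs_nonneg _) ?_ 2
    simpa using (g k).le_of_opNorm_le (hg k) ((w i).2 k)
  have hmem : Memℓp y 2 := by
    refine memℓp_gen ?_
    simpa using summable_of_sum_le (fun k => sq_nonneg ‖y k‖) hysq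
  let v : lp Y 2 := ⟨y, hmem⟩
  refine ⟨(x, v), fun φ => ?_⟩
  have hsq : Summable fun k => ‖S.coord k φ‖ ^ 2 :=
    summable_of_sum_le (fun k => sq_nonneg _) (S.sum_norm_coord_sq_le φ)
  rw [Metric.tendsto_nhds]
  intro ε hε
  obtain ⟨K, hK⟩ := summable_iff_vanishing_norm.1 hsq ((ε * c / 4) ^ 2) (by positivity)
  have hK' : ∀ t : Finset ℕ, Disjoint t K → ∑ k ∈ t, ‖S.coord k φ‖ ^ 2 ≤ (ε * c / 4) ^ 2 :=
    fun t ht => (le_abs_self _).trans (hK t ht).le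
  have htrunc : ∀ u : S.Sigma, (∀ s : Finset ℕ, ∑ k ∈ s, ‖u.2 k‖ ^ 2 ≤ (1 / c) ^ 2) →
      |φ u - (S.left φ u.1 + ∑ k ∈ K, S.coord k φ (u.2 k))| ≤ ε / 4 := by
    classical
    intro u hu
    have h1 : Tendsto (fun s => |∑ k ∈ s, S.coord k φ (u.2 k) - ∑ k ∈ K, S.coord k φ (u.2 k)|)
        atTop (𝓝 |φ u - S.left φ u.1 - ∑ k ∈ K, S.coord k φ (u.2 k)|) :=
      (Tendsto.sub_const (S.hasSum_coord φ u) _).abs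
    rw [← sub_sub]
    refine le_of_tendsto h1 ((eventually_ge_atTop K).mono fun s hs => ?_)
    rw [← Finset.sum_sdiff hs, add_sub_cancel_right]
    refine (Finset.abs_sum_le_sum_abs _ _).trans ?_
    refine (Finset.sum_le_sum fun k _ => (S.coord k φ).le_opNorm (u.2 k)).trans ?_
    refine (sum_mul_le_of_sq_le (s \ K) (by positivity) (by positivity)
      (hK' _ Finset.sdiff_disjoint) (hu _)).trans_eq ?_
    field_simp
  have hlim : Tendsto (fun i => S.left φ (w i).1 + ∑ k ∈ K, S.coord k φ ((w i).2 k)) U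
      (𝓝 (S.left φ x + ∑ k ∈ K, S.coord k φ (y k))) :=
    (hx _).add (tendsto_finsetSum K fun k _ => hy k _)
  filter_upwards [Metric.tendsto_nhds.1 hlim (ε / 4) (by positivity)] with i hi
  have h1 := htrunc (w i) (hwsq i)
  have h2 := htrunc (x, v) hysq
  rw [Real.dist_eq] at hi ⊢
  change |φ (x, v) - (S.left φ x + ∑ k ∈ K, S.coord k φ (y k))| ≤ ε / 4 at h2
  rw [abs_le] at h1 h2
  rw [abs_lt] at hi ⊢
  constructor <;> linarith

/-- The supremum defining the norm of `S.Sigma` is attained. -/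
theorem exists_isLam_apply_eq_norm (z : S.Sigma) :
    ∃ (φ : StrongDual ℝ S.Sigma) (f : StrongDual ℝ X) (g : ∀ k, StrongDual ℝ (Y k))
      (α : ℕ → ℝ), S.IsLam φ f g α ∧ φ z = ‖z‖ := by
  have hseq : ∀ n : ℕ, ∃ (φ : StrongDual ℝ S.Sigma) (f : StrongDual ℝ X)
      (g : ∀ k, StrongDual ℝ (Y k)) (α : ℕ → ℝ),
      ‖φ‖ ≤ 1 ∧ S.IsLam φ f g α ∧ ‖z‖ - 1 / (n + 1) < φ z := by
    intro n
    have hne : {r : ℝ | ∃ φ ∈ S.Lam, r = |φ z|}.Nonempty := ⟨_, 0, S.zero_mem_Lam, rfl⟩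
    obtain ⟨_, ⟨φ, hφ, rfl⟩, hlt⟩ := exists_lt_of_lt_csSup hne
      (show ‖z‖ - 1 / (n + 1) < sSup {r : ℝ | ∃ φ ∈ S.Lam, r = |φ z|} from
        sub_lt_self _ (by positivity))
    obtain ⟨ψ, f, g, α, hψ, hn, hlam⟩ := exists_isLam_of_mem_Lam hφ
    rw [← hψ] at hlt
    rcases le_total 0 (ψ z) with h | h
    · exact ⟨ψ, f, g, α, hn, hlam, by rwa [abs_of_nonneg h] at hlt⟩
    · refine ⟨-ψ, -f, fun k => -g k, α, by rwa [norm_neg], hlam.neg, ?_⟩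
      rwa [abs_of_nonpos h] at hlt
  choose φ f g α hn hlam hlt using hseq
  -- Compactness of Λ: functionals, their components and coefficients all converge along U, and the
  -- defining inequalities of Λ are closed under pointwise limits.
  let U : Ultrafilter ℕ := hyperfilter ℕ
  obtain ⟨ψ, -, hψ⟩ := exists_pointwise_limit U φ hn
  have hg1 : ∀ n k, ‖g n k‖ ≤ 1 := fun n k =>
    (S.norm_le_norm_functional_right k (f n) (g n k)).trans ((hlam n).norm_le k)
  choose G _ hG using fun k => exists_pointwise_limit U (fun n => g n k) (fun n => hg1 n k)
  have hα : ∀ k, ∃ a, Tendsto (fun n => α n k) U (𝓝 a) := by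
    intro k
    have hmem : ∀ n, α n k ∈ Set.Icc (0 : ℝ) 1 := fun n => by
      refine ⟨(hlam n).nonneg k, ?_⟩
      have := (hlam n).sum_sq_le {k}
      rw [Finset.sum_singleton] at this
      nlinarith [(hlam n).nonneg k]
    obtain ⟨a, -, ha⟩ := isCompact_Icc.ultrafilter_le_nhds (U.map fun n => α n k) (by
      rw [le_principal_iff]
      exact Filter.mem_map.2 (Filter.univ_mem' hmem))
    exact ⟨a, ha⟩
  choose a ha using hα
  refine ⟨ψ, S.left ψ, G, a, ⟨rfl, fun k => ?_, fun k => ?_, fun k => ?_, fun s => ?_⟩, ?_⟩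
  · ext y
    refine tendsto_nhds_unique (hψ (Sigma.single S k y)) ?_
    have h1 : ∀ n, φ n (Sigma.single S k y) = α n k * g n k y := fun n => by
      rw [← coord_apply, (hlam n).coord_eq]; rfl
    simp only [h1]
    exact (ha k).mul (hG k y)
  · refine ContinuousLinearMap.opNorm_le_bound _ zero_le_one fun w => ?_
    have h1 : Tendsto (fun n => Pair.functional S k (f n) (g n k) w) U
        (𝓝 (Pair.functional S k (S.left ψ) (G k) w)) := by
      have h2 : ∀ n, Pair.functional S k (f n) (g n k) w =
          φ n (Sigma.inl S w.1) + g n k w.2 := fun n => by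
        rw [Pair.functional_apply, ← (hlam n).left_eq, left_apply]
      simp only [h2]
      exact (hψ _).add (hG k w.2)
    exact le_of_tendsto h1.norm (Eventually.of_forall fun n =>
      (Pair.functional S k (f n) (g n k)).le_of_opNorm_le ((hlam n).norm_le k) w)
  · exact ge_of_tendsto (ha k) (Eventually.of_forall fun n => (hlam n).nonneg k)
  · exact le_of_tendsto (tendsto_finsetSum s fun k _ => (ha k).pow 2)
      (Eventually.of_forall fun n => (hlam n).sum_sq_le s)
  · refine le_antisymm ?_ ?_
    · exact le_of_tendsto (hψ z) (Eventually.of_forall fun n =>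
        (le_abs_self _).trans ((hlam n).abs_apply_le z))
    · have h0 : Tendsto (fun n : ℕ => ‖z‖ - 1 / ((n : ℝ) + 1)) U (𝓝 ‖z‖) := by
        have h1 : Tendsto (fun n : ℕ => 1 / ((n : ℝ) + 1)) U (𝓝 0) :=
          tendsto_one_div_add_atTop_nhds_zero_nat.mono_left Nat.hyperfilter_le_atTop
        simpa using h1.const_sub ‖z‖
      exact le_of_tendsto_of_tendsto h0 (hψ z) (Eventually.of_forall fun n => (hlt n).le)

end

end SumNorms

/-! ### Transfer from Λ to arbitrary functionals -/

theorem mainTheorem4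
    {X : Type*} [NormedAddCommGroup X] [NormedSpace ℝ X] [CompleteSpace X]
    {Y : ℕ → Type*} [∀ k, NormedAddCommGroup (Y k)] [∀ k, NormedSpace ℝ (Y k)]
    [∀ k, CompleteSpace (Y k)]
    (S : SumNorms X Y)
    (hsmooth : ∀ k, FrechetSmooth (StrongDual ℝ (S.Pair k)))
    (c : ℝ) (hc : 0 < c)
    (hlower : ∀ k (x : X) (y : Y k), ‖x‖ + c * ‖y‖ ≤ S.nrm k (x, y)) :
    FrechetSmooth (StrongDual ℝ S.Sigma) := by
  intro φ hφ
  have hφpos : 0 < ‖φ‖ := norm_pos_iff.2 hφ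
  let U : Ultrafilter ℕ := hyperfilter ℕ
  have hlim0 : Tendsto (fun n : ℕ => ‖φ‖ - 1 / ((n : ℝ) + 1)) U (𝓝 ‖φ‖) := by
    have h1 : Tendsto (fun n : ℕ => 1 / ((n : ℝ) + 1)) U (𝓝 0) :=
      tendsto_one_div_add_atTop_nhds_zero_nat.mono_left Nat.hyperfilter_le_atTop
    simpa using h1.const_sub ‖φ‖
  have hweak : ∀ w : ℕ → S.Sigma, (∀ n, ‖w n‖ ≤ 1) →
      (∀ n : ℕ, ‖φ‖ - 1 / ((n : ℝ) + 1) < φ (w n)) →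
      ∃ z : S.Sigma, ‖z‖ ≤ 1 ∧ φ z = ‖φ‖ ∧
        ∀ ψ : StrongDual ℝ S.Sigma, Tendsto (fun n => ψ (w n)) U (𝓝 (ψ z)) := by
    intro w hw hφw
    obtain ⟨z, hz⟩ := S.exists_weak_limit hc hlower
      (S.frechetSmooth_dual_left (hsmooth 0)).exists_eq_inclusionInDoubleDual
      (fun k => S.exists_eq_apply_right (hsmooth k)) U w hw
    -- Weak lower semicontinuity of the norm, through a functional in Λ attaining ‖z‖.
    have hz1 : ‖z‖ ≤ 1 := by
      obtain ⟨ψ, f, g, α, hψ, hψz⟩ := S.exists_isLam_apply_eq_norm z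
      rw [← hψz]
      exact le_of_tendsto (hz ψ) (Eventually.of_forall fun n =>
        ((le_abs_self _).trans (hψ.abs_apply_le _)).trans (hw n))
    refine ⟨z, hz1, le_antisymm ?_ ?_, hz⟩
    · exact ((le_abs_self _).trans (φ.le_opNorm z)).trans
        (mul_le_of_le_one_right (norm_nonneg _) hz1)
    · exact le_of_tendsto_of_tendsto hlim0 (hz φ) (Eventually.of_forall fun n => (hφw n).le)
  choose w₀ hw₀ hφw₀ using fun n : ℕ => exists_almost_norming φ
    (show (0 : ℝ) < 1 / ((n : ℝ) + 1) by positivity)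
  obtain ⟨z, hz, hφz, -⟩ := hweak w₀ hw₀ hφw₀
  refine differentiableAt_norm_of_slices hz hφz fun ε hε => ?_
  by_contra! hcon
  choose w hw hφw hwz using fun n : ℕ => hcon (1 / ((n : ℝ) + 1)) (by positivity)
  obtain ⟨z', hz', hφz', hlim⟩ := hweak w hw hφw
  -- φ itself need not be a multiple of an element of Λ; it is replaced by ψ, which norms both z and
  -- z' since ‖z + z'‖ ≥ 2.
  obtain ⟨ψ, f, g, α, hψ, hψz⟩ := S.exists_isLam_apply_eq_norm (z + z')
  have hsum : 2 ≤ ‖z + z'‖ := by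
    have h1 := (le_abs_self _).trans (φ.le_opNorm (z + z'))
    rw [map_add, hφz, hφz'] at h1
    have h2 : ‖φ‖ * 2 ≤ ‖φ‖ * ‖z + z'‖ := by linarith
    exact le_of_mul_le_mul_left h2 hφpos
  have hle1 : ψ z ≤ 1 := ((le_abs_self _).trans (hψ.abs_apply_le z)).trans hz
  have hle2 : ψ z' ≤ 1 := ((le_abs_self _).trans (hψ.abs_apply_le z')).trans hz'
  rw [map_add] at hψz
  have h1 : ψ z = 1 := by linarith
  have h2 : ψ z' = 1 := by linarith
  obtain ⟨δ, hδ, hslice⟩ := hψ.slices_shrink hsmooth hc hlower hz h1 hε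
  have hev : ∀ᶠ n in (U : Filter ℕ), 1 - δ < ψ (w n) := by
    have h3 := hlim ψ
    rw [h2] at h3
    exact h3.eventually_const_lt (by linarith)
  obtain ⟨n, hn⟩ := hev.exists
  exact absurd (hslice (w n) z (hw n) hz hn (by linarith)) (not_le.2 (hwz n))
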